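/- Let $n \ge 0$. A function $K\colon \mathbb{R}^n\times\mathbb{R}^n\to\mathbb{R}$ is called a positive definite kernel if $K(x,y)=K(y,x)$ for all $x,y$ and $\sum_{x,y\in C}c_xc_yK(x,y)\ge 0$ for all finite $C\subseteq\mathbb{R}^n$ and $c\in\mathbb{R}^C$. Write $\widehat f(y)=\int_{\mathbb{R}^n} f(x)e^{-2\pi i\langle x,y\rangle}\,dx$, and let $B_\rho^n$ be the closed ball of radius $\rho$ about the origin in $\mathbb{R}^n$. **The strengthened bound.** For $0<r<R\le\infty$, let $\Delta^{\mathrm{str}}_n(r,R)$ be the infimum of $$\operatorname{vol}(B_{r/2}^n)\,\bigl(f_2(0)+f_3(0,0)\bigr)$$ over all $f_2\colon\mathbb{R}^n\to\mathbb{R}$ and $f_3\colon\mathbb{R}^n\times\mathbb{R}^n\to\mathbb{R}$ such that $f_2$ is continuous and integrable, $\widehat f_2(0)=1$, $\widehat f_2\ge 0$ everywhere, $f_3$ is a positive definite kernel (not necessarily continuous) with $f_3(x,y)=0$ unless $|x|,|y|\le R$, and - $f_2(x)+f_3(x,0)+f_3(0,x)+f_3(x,x)\le 0$ whenever $r\le|x|\le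 R$, - $f_2(x)\le 0$ whenever $|x|\ge R$, - $f_3(x,y)+f_3(-x,y-x)+f_3(-y,x-y)\le 0$ whenever $|x|,|y|,|x-y|\ge r$ and $|x|,|y|\le R$. For $R=\infty$ the second inequality and the vanishing condition on $f_3$ are vacuous. **The Euclidean three-point bound.** Let $I_m$ be the space of sets $J \subseteq \mathbb{R}^n$ of at most $m$ points with pairwise distances at least $2$, with the quotient topology from tuples of points ($\emptyset$ is an isolated point). For $f\colon\mathbb{R}^n\times\mathbb{R}^n\times I_1\to\mathbb{R}$ and a nonempty $S\in I_3$, let $$B_3f(S)=\sum_{\substack{J\subseteq S\\ |J|\le 1}}\ \sum_{\substack{x,y\in S\\ \{x,y\}\cup J=S}}f(x,y,J).$$ Let $\Delta_{3,\mathbb{R}^n}$ be the infimum of $\operatorname{vol}(B_1^n)\,B_3f(\{0\})$ over all continuous $f\colon\mathbb{R}^n\times\mathbb{R}^n\times I_1\to\mathbb{R}$ such that $f(x+z,y+z,J+z)=f(x,y,J)$ for all $x,y,z\in\mathbb{R}^n$ and $J\in I_1$; $(x,y)\mapsto f(x,y,J)$ is a positive definite kernel for each $J \in I_1$; $B_3f(S)\le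 0$ for all $S\in I_3$ with $|S|\ge 2$; and $x\mapsto f(x,0,\emptyset)$ is integrable with $\int_{\mathbb{R}^n}f(x,0,\emptyset)\,dx=1$. **Theorem.** For every $r>0$, $$\Delta^{\mathrm{str}}_n(r,\infty)=\Delta_{3,\mathbb{R}^n},$$ and also $$\inf_{0<r<R<\infty}\Delta^{\mathrm{str}}_n(r,R)=\Delta_{3,\mathbb{R}^n}.$$ -/

import Mathlib

open MeasureTheory FourierTransform
open scoped ComplexOrder

noncomputable section

/-- Euclidean space `ℝⁿ`. -/
abbrev Euc (n : ℕ) : Type := EuclideanSpace ℝ (Fin n)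

/-- The graph on `ℝⁿ` in which `x` and `y` are adjacent if and only if `0 < |x - y| < 2`. -/
def packingGraph (n : ℕ) : SimpleGraph (Euc n) where
  Adj x y := 0 < ‖x - y‖ ∧ ‖x - y‖ < 2
  symm := ⟨fun x y h => by rwa [norm_sub_rev y x]⟩
  loopless := ⟨fun x h => by simp at h⟩

/-- `I_m`: the independent sets of at most `m` points in the packing graph of `ℝⁿ`. -/
def IndepSet (n m : ℕ) : Type :=
  {J : Finset (Euc n) // (packingGraph n).IsIndepSet (J : Set (Euc n)) ∧ J.card ≤ m}

open Classical in
/-- The independent set `{v₀, …, v_{j-1}}` listed by a tuple `v` of length `j ≤ m`. -/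
def IndepSet.ofTuple {n m : ℕ} (j : Fin (m + 1))
    (v : {v : Fin j → Euc n // (packingGraph n).IsIndepSet (Set.range v)}) : IndepSet n m :=
  ⟨Finset.univ.image v.1, by
    refine ⟨by simpa using v.2, ?_⟩
    have h := Finset.card_image_le (s := (Finset.univ : Finset (Fin j))) (f := v.1)
    have hj := j.2
    simp only [Finset.card_univ, Fintype.card_fin] at h
    omega⟩

/-- The topology of `I_m`: the quotient topology from tuples of points
(the empty set, which comes from the empty tuple, is an isolated point). -/
instance IndepSet.instTopologicalSpace (n m : ℕ) : TopologicalSpace (IndepSet n m) :=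
  ⨆ j : Fin (m + 1), TopologicalSpace.coinduced (IndepSet.ofTuple (n := n) j) inferInstance

/-- The translate `J + z = {j + z : j ∈ J}`. -/
def IndepSet.translate {n m : ℕ} (J : IndepSet n m) (z : Euc n) : IndepSet n m :=
  ⟨J.1.map (addRightEmbedding z), by
    refine ⟨?_, by simpa using J.2.2⟩
    rintro a ha b hb hab h
    simp only [Finset.coe_map, Set.mem_image, addRightEmbedding_apply] at ha hb
    obtain ⟨a, ha, rfl⟩ := ha
    obtain ⟨b, hb, rfl⟩ := hb
    refine J.2.1 ha hb (fun e => hab (by rw [e])) ?_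
    simpa [packingGraph] using h⟩

/-- A function `K : ℝⁿ × ℝⁿ → ℝ` is positive definite as a kernel. -/
def IsPosDefKernel {n : ℕ} (K : Euc n → Euc n → ℝ) : Prop :=
  (∀ x y, K x y = K y x) ∧
    ∀ (C : Finset (Euc n)) (c : Euc n → ℝ), 0 ≤ ∑ x ∈ C, ∑ y ∈ C, c x * c y * K x y

open Classical in
/-- The operator `B_k` (for `k ≥ 2`): for an independent set `S`,
`B_k T(S) = ∑_{J ⊆ S, |J| ≤ k - 2} ∑_{x, y ∈ S, {x, y} ∪ J = S} T(x, y, J)`. -/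
def opB {n : ℕ} (k : ℕ) (T : Euc n × Euc n × IndepSet n (k - 2) → ℝ)
    (S : Finset (Euc n)) (hS : (packingGraph n).IsIndepSet (S : Set (Euc n))) : ℝ :=
  ∑ J ∈ (S.powerset.filter (fun J => J.card ≤ k - 2)).attach,
    ∑ p ∈ (S ×ˢ S).filter (fun p => {p.1, p.2} ∪ J.1 = S),
      T (p.1, p.2, ⟨J.1, by
        have h := J.2
        rw [Finset.mem_filter, Finset.mem_powerset] at h
        exact ⟨hS.mono (Finset.coe_subset.2 h.1), h.2⟩⟩)

theorem isIndepSet_singleton {n : ℕ} (x : Euc n) :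
    (packingGraph n).IsIndepSet ((({x} : Finset (Euc n))) : Set (Euc n)) := by
  simp [SimpleGraph.IsIndepSet]

/-- The feasible functions of the Euclidean `k`-point bound. -/
structure IsKPointFeasible (n k : ℕ) (f : Euc n × Euc n × IndepSet n (k - 2) → ℝ) : Prop where
  continuous : Continuous f
  translation_invariant : ∀ (x y z : Euc n) (J : IndepSet n (k - 2)),
    f (x, y, J) = f (x + z, y + z, J.translate z)
  posDef : ∀ J : IndepSet n (k - 2), IsPosDefKernel (fun x y => f (x, y, J))
  opB_nonpos : ∀ (S : Finset (Euc n)) (hS : (packingGraph n).IsIndepSet (S : Set (Euc n))),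
    2 ≤ S.card → S.card ≤ k → opB k f S hS ≤ 0
  integrable : Integrable (fun x => f (x, 0, ⟨∅, by simp [SimpleGraph.IsIndepSet]⟩)) volume
  integral_eq_one : ∫ x, f (x, 0, ⟨∅, by simp [SimpleGraph.IsIndepSet]⟩) = 1

/-- The `k`-point sphere packing density bound `Δ_{k,ℝⁿ}` (for `k ≥ 2`). The infimum is taken in
the extended reals, so that no boundedness or nonemptiness is presupposed. -/
def kPointBound (k n : ℕ) : EReal :=
  sInf {v : EReal | ∃ f : Euc n × Euc n × IndepSet n (k - 2) → ℝ, IsKPointFeasible n k f ∧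
    v = ((volume.real (Metric.closedBall (0 : Euc n) 1) *
      opB k f {0} (isIndepSet_singleton 0) : ℝ) : EReal)}

/-- The hypotheses of the truncated three-point bound with packing distance `r` and truncation
radius `R ∈ (r, ∞]`, with the inequality `f₃(x,y) ≤ 0` weakened to its symmetrization.
For finite `R` the function `f₃` is extended by zero from `|x|, |y| ≤ R`
(for `R = ∞` the conditions `vanish` and `two_point_outer` are vacuous). -/
structure IsStrengthenedFeasible (n : ℕ) (r : ℝ) (R : EReal)
    (f₂ : Euc n → ℝ) (f₃ : Euc n → Euc n → ℝ) : Prop where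
  continuous : Continuous f₂
  integrable : Integrable f₂ volume
  fourier_zero : 𝓕 (fun x => (f₂ x : ℂ)) (0 : Euc n) = 1
  fourier_nonneg : ∀ w : Euc n, 0 ≤ 𝓕 (fun x => (f₂ x : ℂ)) w
  posDef : IsPosDefKernel f₃
  vanish : ∀ x y : Euc n, (R < (‖x‖ : ℝ) ∨ R < (‖y‖ : ℝ)) → f₃ x y = 0
  two_point : ∀ x : Euc n, r ≤ ‖x‖ → ((‖x‖ : ℝ) : EReal) ≤ R →
    f₂ x + f₃ x 0 + f₃ 0 x + f₃ x x ≤ 0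
  two_point_outer : ∀ x : Euc n, R ≤ (‖x‖ : ℝ) → f₂ x ≤ 0
  three_point : ∀ x y : Euc n, r ≤ ‖x‖ → r ≤ ‖y‖ → r ≤ ‖x - y‖ →
    ((‖x‖ : ℝ) : EReal) ≤ R → ((‖y‖ : ℝ) : EReal) ≤ R →
    f₃ x y + f₃ (-x) (y - x) + f₃ (-y) (x - y) ≤ 0

/-- The infimum of the bounds `vol(B_{r/2}) (f₂(0) + f₃(0,0))` for given `r` and `R`. -/
def strengthenedBound (n : ℕ) (r : ℝ) (R : EReal) : EReal :=
  sInf {v : EReal | ∃ (f₂ : Euc n → ℝ) (f₃ : Euc n → Euc n → ℝ),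
    IsStrengthenedFeasible n r R f₂ f₃ ∧
    v = ((volume.real (Metric.closedBall (0 : Euc n) (r / 2)) * (f₂ 0 + f₃ 0 0) : ℝ) : EReal)}

end

/-!
The three-point bound and the strengthened bound are compared through *feasible pairs*
(`IsFeasiblePair`): pairs `(f₂, f₃)` subject to the constraints of the strengthened bound at
`R = ∞`, with `f̂₂ ≥ 0` replaced by positive definiteness of `f₂ (x - y)` and without the
normalisation `∫ f₂ = 1`. The value of a pair is `vol(B_{r/2}) (f₂ 0 + f₃ 0 0) / ∫ f₂`, which does
not change under dilations of space, so `r` is arbitrary. The exchange of the Fourier condition is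
Bochner's theorem for continuous integrable functions, proved in both directions
(`fourier_nonneg_of_isPosDefKernel`, `isPosDefKernel_of_fourier_nonneg`). A finite truncation
radius only makes the constraints stronger (`IsStrengthenedFeasible.isFeasiblePair`).

From a feasible function `f` of the three-point bound one takes `f₂ x = f (x, 0, ∅)` and
`f₃ x y = f (x, y, {0})`, symmetrised under `x ↦ -x` (`IsKPointFeasible.isFeasiblePair`); the values
of `B₃ f` on `{0, x}` and `{0, x, y}` are then sums of the two-point and three-point constraints.

A pair is truncated by multiplying `f₂ x` and `f₃ x y` with the normalised volumes of
`ρB ∩ (ρB + x)` and `ρB ∩ (ρB + x) ∩ (ρB + y)` (`IsFeasiblePair.truncate`). These multipliers are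
positive definite, agree on all the terms of any one constraint, have bounded support, and tend
to `1` as `ρ → ∞`. This gives the infimum over finite `R`.

In the remaining direction `f₃` may fail to be measurable, so that it cannot be mollified. Instead
all points are rounded to a grid of small mesh `ε`, randomly shifted: with `T_u` the rounding for
the shift `u ∈ (ℝ/ℤ)ⁿ`, the average over `u` of `f₂ (T_u x - T_u y)` at `J = ∅` and of
`f₃ (T_u x - T_u z) (T_u y - T_u z)` at `J = {z}` is feasible for the three-point bound
(`isKPointFeasible_gridKernel`). Differences of rounded points lie in the lattice `ε ℤⁿ`, so no
regularity of `f₃` is needed for the average to exist; it is continuous because `T_u` is locally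
constant at a given point for almost every `u`, translation invariant because Haar measure is, and
it inherits positive definiteness and the constraints because these hold for each `u`, provided
that the pair is feasible at some distance `r < 2`, which leaves room for the rounding. A dilation
provides such an `r`, and a truncation makes the integral of the averaged `f₂` converge to that of
`f₂` as `ε → 0`.
-/

open Filter Topology

/-! ### Positive definite kernels -/

theorem IsPosDefKernel.sum_nonneg {n : ℕ} {K : Euc n → Euc n → ℝ} (hK : IsPosDefKernel K)
    {ι : Type*} (s : Finset ι) (p : ι → Euc n) (c : ι → ℝ) :
    0 ≤ ∑ i ∈ s, ∑ j ∈ s, c i * c j * K (p i) (p j) := by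
  classical
  have h := hK.2 (s.image p) (fun a => ∑ i ∈ s with p i = a, c i)
  have hmaps : ∀ i ∈ s, p i ∈ s.image p := fun i hi => Finset.mem_image_of_mem p hi
  rw [← Finset.sum_fiberwise_of_maps_to hmaps]
  refine h.trans_eq (Finset.sum_congr rfl fun a _ => ?_)
  simp_rw [← Finset.sum_fiberwise_of_maps_to hmaps (fun j => c _ * c j * K (p _) (p j))]
  rw [Finset.sum_comm]
  refine Finset.sum_congr rfl fun b _ => ?_
  rw [Finset.sum_mul_sum, Finset.sum_mul]
  refine Finset.sum_congr rfl fun i hi => ?_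
  rw [Finset.sum_mul]
  refine Finset.sum_congr rfl fun j hj => ?_
  rw [(Finset.mem_filter.1 hi).2, (Finset.mem_filter.1 hj).2]

theorem IsPosDefKernel.comp {n m : ℕ} {K : Euc n → Euc n → ℝ} (hK : IsPosDefKernel K)
    (T : Euc m → Euc n) : IsPosDefKernel fun x y => K (T x) (T y) :=
  ⟨fun _ _ => hK.1 _ _, fun C c => hK.sum_nonneg C T c⟩

theorem IsPosDefKernel.mul_diag {n : ℕ} {K : Euc n → Euc n → ℝ} (hK : IsPosDefKernel K)
    (g : Euc n → ℝ) : IsPosDefKernel fun x y => K x y * (g x * g y) := by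
  refine ⟨fun x y => by simp only [hK.1 x y, mul_comm (g x)], fun C c => ?_⟩
  refine (hK.2 C fun x => c x * g x).trans_eq ?_
  exact Finset.sum_congr rfl fun x _ => Finset.sum_congr rfl fun y _ => by ring

theorem IsPosDefKernel.add {n : ℕ} {K L : Euc n → Euc n → ℝ} (hK : IsPosDefKernel K)
    (hL : IsPosDefKernel L) : IsPosDefKernel fun x y => K x y + L x y := by
  refine ⟨fun x y => by simp only [hK.1 x y, hL.1 x y], fun C c => ?_⟩
  simp only [mul_add, Finset.sum_add_distrib]
  exact add_nonneg (hK.2 C c) (hL.2 C c)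

theorem IsPosDefKernel.const_mul {n : ℕ} {K : Euc n → Euc n → ℝ} (hK : IsPosDefKernel K)
    {a : ℝ} (ha : 0 ≤ a) : IsPosDefKernel fun x y => a * K x y := by
  refine ⟨fun x y => by simp only [hK.1 x y], fun C c => ?_⟩
  refine (mul_nonneg ha (hK.2 C c)).trans_eq ?_
  simp only [Finset.mul_sum]
  exact Finset.sum_congr rfl fun x _ => Finset.sum_congr rfl fun y _ => by ring

theorem IsPosDefKernel.of_tendsto {n : ℕ} {ι : Type*} {l : Filter ι} [l.NeBot]
    {K : ι → Euc n → Euc n → ℝ} {L : Euc n → Euc n → ℝ} (hK : ∀ᶠ i in l, IsPosDefKernel (K i))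
    (h : ∀ x y, Tendsto (fun i => K i x y) l (𝓝 (L x y))) : IsPosDefKernel L := by
  refine ⟨fun x y => ?_, fun C c => ?_⟩
  · exact tendsto_nhds_unique ((h x y).congr' (hK.mono fun i hi => hi.1 x y)) (h y x)
  · refine ge_of_tendsto (tendsto_finsetSum _ fun x _ => tendsto_finsetSum _ fun y _ =>
      (h x y).const_mul (c x * c y)) (hK.mono fun i hi => hi.2 C c)

theorem IsPosDefKernel.integral {n : ℕ} {α : Type*} [MeasurableSpace α] {μ : Measure α}
    {K : α → Euc n → Euc n → ℝ} (hK : ∀ z, IsPosDefKernel (K z))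
    (hi : ∀ x y, Integrable (fun z => K z x y) μ) :
    IsPosDefKernel fun x y => ∫ z, K z x y ∂μ := by
  refine ⟨fun x y => integral_congr_ae (.of_forall fun z => (hK z).1 x y), fun C c => ?_⟩
  have h : ∑ x ∈ C, ∑ y ∈ C, c x * c y * ∫ z, K z x y ∂μ
      = ∫ z, ∑ x ∈ C, ∑ y ∈ C, c x * c y * K z x y ∂μ := by
    rw [integral_finsetSum _ fun x _ => integrable_finsetSum _ fun y _ => (hi x y).const_mul _]
    refine Finset.sum_congr rfl fun x _ => ?_
    rw [integral_finsetSum _ fun y _ => (hi x y).const_mul _]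
    exact Finset.sum_congr rfl fun y _ => (integral_const_mul _ _).symm
  rw [h]
  exact integral_nonneg fun z => (hK z).2 C c

theorem IsPosDefKernel.abs_le {n : ℕ} {K : Euc n → Euc n → ℝ} (hK : IsPosDefKernel K)
    (x y : Euc n) : |K x y| ≤ (K x x + K y y) / 2 := by
  have h1 := hK.sum_nonneg Finset.univ ![x, y] ![1, 1]
  have h2 := hK.sum_nonneg Finset.univ ![x, y] ![1, -1]
  simp [Fin.sum_univ_two, hK.1 y x] at h1 h2
  rw [_root_.abs_le]
  constructor <;> linarith

/-- By the addition formula, `cos (θ x - θ y)` is a sum of two kernels of the form `g x * g y`. -/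
theorem IsPosDefKernel.mul_cos {n : ℕ} {K : Euc n → Euc n → ℝ} (hK : IsPosDefKernel K)
    (θ : Euc n → ℝ) : IsPosDefKernel fun x y => K x y * Real.cos (θ x - θ y) := by
  have h := (hK.mul_diag fun x => Real.cos (θ x)).add (hK.mul_diag fun x => Real.sin (θ x))
  simpa only [Real.cos_sub, mul_add] using h

theorem isPosDefKernel_const {n : ℕ} {a : ℝ} (ha : 0 ≤ a) :
    IsPosDefKernel fun _ _ : Euc n => a := by
  refine ⟨fun _ _ => rfl, fun C c => ?_⟩
  have : ∑ x ∈ C, ∑ y ∈ C, c x * c y * a = a * (∑ x ∈ C, c x) ^ 2 := by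
    rw [sq, Finset.sum_mul_sum, Finset.mul_sum]
    simp only [Finset.mul_sum]
    exact Finset.sum_congr rfl fun x _ => Finset.sum_congr rfl fun y _ => by ring
  rw [this]
  positivity

/-- A bounded continuous positive definite kernel has a nonnegative double integral against every
finite measure: approximate the identity by simple functions, for which the double integral is
one of the sums in the definition of positive definiteness. -/
theorem IsPosDefKernel.integral_prod_nonneg {n : ℕ} {K : Euc n → Euc n → ℝ}
    (hK : IsPosDefKernel K) (hc : Continuous fun p : Euc n × Euc n => K p.1 p.2) {M : ℝ}
    (hM : ∀ x y, |K x y| ≤ M) (μ : Measure (Euc n)) [IsFiniteMeasure μ] :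
    0 ≤ ∫ p, K p.1 p.2 ∂(μ.prod μ) := by
  let s : ℕ → SimpleFunc (Euc n) (Euc n) := fun k =>
    SimpleFunc.approxOn id measurable_id Set.univ 0 (Set.mem_univ _) k
  have hs : ∀ x, Tendsto (fun k => s k x) atTop (𝓝 x) := fun x =>
    SimpleFunc.tendsto_approxOn measurable_id (Set.mem_univ _) (by simp)
  have hmeas : ∀ k, Measurable fun p : Euc n × Euc n => K (s k p.1) (s k p.2) := fun k =>
    hc.measurable.comp (((s k).measurable.comp measurable_fst).prodMk
      ((s k).measurable.comp measurable_snd))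
  have hlim : Tendsto (fun k => ∫ p, K (s k p.1) (s k p.2) ∂(μ.prod μ)) atTop
      (𝓝 (∫ p, K p.1 p.2 ∂(μ.prod μ))) := by
    refine tendsto_integral_of_dominated_convergence (fun _ => M)
      (fun k => (hmeas k).aestronglyMeasurable) (integrable_const M)
      (fun k => .of_forall fun p => hM _ _) (.of_forall fun p => ?_)
    exact (hc.tendsto p).comp ((hs p.1).prodMk_nhds (hs p.2))
  refine ge_of_tendsto hlim (.of_forall fun k => ?_)
  have hsum : ∀ g : Euc n → ℝ, ∫ x, g (s k x) ∂μ =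
      ∑ a ∈ (s k).range, μ.real (s k ⁻¹' {a}) * g a := by
    intro g
    have hg : ∀ x, g (s k x) =
        ∑ a ∈ (s k).range, (s k ⁻¹' {a}).indicator (fun _ => g a) x := by
      intro x
      rw [Finset.sum_eq_single_of_mem (s k x) (SimpleFunc.mem_range_self _ x)]
      · simp
      · intro a _ ha
        exact Set.indicator_of_notMem (fun h => ha (by simpa using h.symm)) _
    simp_rw [hg]
    rw [integral_finsetSum _ fun a _ =>
      (integrable_const (g a)).indicator ((s k).measurableSet_fiber a)]
    refine Finset.sum_congr rfl fun a _ => ?_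
    rw [integral_indicator_const _ ((s k).measurableSet_fiber a), smul_eq_mul]
  rw [integral_prod _ (Integrable.of_bound (hmeas k).aestronglyMeasurable M
    (.of_forall fun p => hM _ _))]
  simp_rw [hsum]
  rw [hsum fun a => ∑ b ∈ (s k).range, μ.real (s k ⁻¹' {b}) * K a b]
  refine (hK.2 (s k).range fun a => μ.real (s k ⁻¹' {a})).trans_eq ?_
  refine Finset.sum_congr rfl fun a _ => ?_
  rw [Finset.mul_sum]
  exact Finset.sum_congr rfl fun b _ => by ring

/-! ### Overlaps of three balls -/

/-- The indicator function of the closed unit ball of `ℝⁿ`. -/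
noncomputable def ballIndicator (n : ℕ) : Euc n → ℝ := (Metric.closedBall 0 1).indicator 1

/-- The normalised volume of `B ∩ (B + x) ∩ (B + y)`, where `B` is the closed unit ball. -/
noncomputable def ballOverlap {n : ℕ} (x y : Euc n) : ℝ :=
  (∫ z, ballIndicator n z * (ballIndicator n (z - x) * ballIndicator n (z - y))) /
    volume.real (Metric.closedBall (0 : Euc n) 1)

theorem ballIndicator_nonneg {n : ℕ} (x : Euc n) : 0 ≤ ballIndicator n x :=
  Set.indicator_nonneg (fun _ _ => zero_le_one) x

theorem ballIndicator_le_one {n : ℕ} (x : Euc n) : ballIndicator n x ≤ 1 :=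
  Set.indicator_le_self' (fun _ _ => zero_le_one) x

theorem abs_ballIndicator_le {n : ℕ} (x : Euc n) : |ballIndicator n x| ≤ 1 := by
  rw [abs_of_nonneg (ballIndicator_nonneg x)]
  exact ballIndicator_le_one x

theorem ballIndicator_mul_self {n : ℕ} (x : Euc n) :
    ballIndicator n x * ballIndicator n x = ballIndicator n x := by
  unfold ballIndicator
  by_cases h : x ∈ Metric.closedBall (0 : Euc n) 1 <;> simp [h]

theorem ballIndicator_eq_zero {n : ℕ} {x : Euc n} (h : 1 < ‖x‖) : ballIndicator n x = 0 :=
  Set.indicator_of_notMem (by simpa using h) _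

@[fun_prop]
theorem measurable_ballIndicator {n : ℕ} : Measurable (ballIndicator n) :=
  measurable_one.indicator measurableSet_closedBall

theorem integrable_ballIndicator {n : ℕ} : Integrable (ballIndicator n) :=
  (integrable_indicator_iff measurableSet_closedBall).2 (by
    refine integrableOn_const (C := (1 : ℝ)) ?_
    exact measure_closedBall_lt_top.ne)

theorem integral_ballIndicator {n : ℕ} :
    ∫ z, ballIndicator n z = volume.real (Metric.closedBall (0 : Euc n) 1) := by
  unfold ballIndicator
  rw [integral_indicator_one measurableSet_closedBall]

theorem volume_closedBall_pos {n : ℕ} :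
    0 < volume.real (Metric.closedBall (0 : Euc n) 1) :=
  ENNReal.toReal_pos (Metric.measure_closedBall_pos _ _ one_pos).ne'
    measure_closedBall_lt_top.ne

theorem integrable_ballIndicator_mul {n : ℕ} {f : Euc n → ℝ} (hf : Measurable f) {M : ℝ}
    (h : ∀ x, |f x| ≤ M) : Integrable fun z => ballIndicator n z * f z :=
  integrable_ballIndicator.mul_bdd hf.aestronglyMeasurable (.of_forall h)

theorem integrable_ballOverlap {n : ℕ} (x y : Euc n) : Integrable fun z =>
    ballIndicator n z * (ballIndicator n (z - x) * ballIndicator n (z - y)) := by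
  refine integrable_ballIndicator_mul (by fun_prop) (M := 1) fun z => ?_
  rw [abs_mul]
  exact mul_le_one₀ (abs_ballIndicator_le _) (abs_nonneg _) (abs_ballIndicator_le _)

theorem ballOverlap_nonneg {n : ℕ} (x y : Euc n) : 0 ≤ ballOverlap x y :=
  div_nonneg (integral_nonneg fun _ => mul_nonneg (ballIndicator_nonneg _)
    (mul_nonneg (ballIndicator_nonneg _) (ballIndicator_nonneg _))) measureReal_nonneg

theorem ballOverlap_le_one {n : ℕ} (x y : Euc n) : ballOverlap x y ≤ 1 := by
  refine (div_le_one volume_closedBall_pos).2 ?_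
  rw [← integral_ballIndicator]
  refine integral_mono (integrable_ballOverlap x y) integrable_ballIndicator fun z => ?_
  exact mul_le_of_le_one_right (ballIndicator_nonneg _)
    (mul_le_one₀ (ballIndicator_le_one _) (ballIndicator_nonneg _) (ballIndicator_le_one _))

theorem ballOverlap_comm {n : ℕ} (x y : Euc n) : ballOverlap x y = ballOverlap y x := by
  unfold ballOverlap
  simp_rw [mul_comm (ballIndicator n (_ - x))]

theorem ballOverlap_self {n : ℕ} (x : Euc n) : ballOverlap x x = ballOverlap x 0 := by
  unfold ballOverlap
  simp_rw [ballIndicator_mul_self, sub_zero, mul_comm (ballIndicator n (_ - x)), ← mul_assoc,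
    ballIndicator_mul_self]

theorem ballOverlap_zero {n : ℕ} : ballOverlap (0 : Euc n) 0 = 1 := by
  unfold ballOverlap
  simp_rw [sub_zero, ballIndicator_mul_self]
  rw [integral_ballIndicator, div_self volume_closedBall_pos.ne']

theorem ballOverlap_zero_right {n : ℕ} (x : Euc n) : ballOverlap x 0 =
    (∫ z, ballIndicator n z * ballIndicator n (z - x)) /
      volume.real (Metric.closedBall (0 : Euc n) 1) := by
  unfold ballOverlap
  simp_rw [sub_zero, mul_comm (ballIndicator n (_ - x)), ← mul_assoc, ballIndicator_mul_self]

/-- Translating all three balls by `-x`. -/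
theorem ballOverlap_neg_sub {n : ℕ} (x y : Euc n) :
    ballOverlap (-x) (y - x) = ballOverlap x y := by
  unfold ballOverlap
  rw [← integral_sub_right_eq_self _ x]
  congr 2 with z
  rw [sub_neg_eq_add, sub_add_cancel, sub_sub_sub_cancel_right]
  ring

theorem ballOverlap_sub {n : ℕ} (x y : Euc n) : ballOverlap (x - y) 0 =
    (∫ z, ballIndicator n (z - x) * ballIndicator n (z - y)) /
      volume.real (Metric.closedBall (0 : Euc n) 1) := by
  rw [ballOverlap_zero_right, ← integral_sub_right_eq_self _ y]
  congr 2 with z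
  rw [sub_sub, add_sub_cancel]
  ring

theorem ballOverlap_eq_zero {n : ℕ} {x : Euc n} (hx : 2 < ‖x‖) (y : Euc n) :
    ballOverlap x y = 0 := by
  have : ∀ z, ballIndicator n z * (ballIndicator n (z - x) * ballIndicator n (z - y)) = 0 := by
    intro z
    by_cases hz : 1 < ‖z‖
    · rw [ballIndicator_eq_zero hz, zero_mul]
    · have h : ‖x‖ ≤ ‖z‖ + ‖z - x‖ := by
        simpa using norm_sub_le z (z - x)
      rw [ballIndicator_eq_zero (x := z - x) (by linarith), zero_mul, mul_zero]
  unfold ballOverlap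
  simp [this]

theorem continuousAt_ballIndicator {n : ℕ} {x : Euc n} (hx : ‖x‖ ≠ 1) :
    ContinuousAt (ballIndicator n) x := by
  rcases hx.lt_or_gt with h | h
  · refine (continuousAt_const (y := (1 : ℝ))).congr ?_
    filter_upwards [(continuous_norm.tendsto x).eventually_lt_const h] with y hy
    simp [ballIndicator, hy.le]
  · refine (continuousAt_const (y := (0 : ℝ))).congr ?_
    filter_upwards [(continuous_norm.tendsto x).eventually_const_lt h] with y hy
    exact (ballIndicator_eq_zero hy).symm

theorem continuous_ballOverlap {n : ℕ} : Continuous fun x : Euc n => ballOverlap x 0 := by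
  simp_rw [ballOverlap_zero_right]
  refine Continuous.div_const (continuous_iff_continuousAt.2 fun x => ?_) _
  refine continuousAt_of_dominated (bound := ballIndicator n)
    (.of_forall fun y => by fun_prop) (.of_forall fun y => .of_forall fun z => ?_)
    integrable_ballIndicator ?_
  · rw [Real.norm_eq_abs, abs_mul, abs_of_nonneg (ballIndicator_nonneg z)]
    exact mul_le_of_le_one_right (ballIndicator_nonneg _) (abs_ballIndicator_le _)
  · have : ∀ᵐ z : Euc n, z ∉ Metric.sphere x 1 :=
      measure_eq_zero_iff_ae_notMem.1 (Measure.addHaar_sphere_of_ne_zero _ _ one_ne_zero)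
    filter_upwards [this] with z hz
    have h := continuousAt_ballIndicator (x := z - x) (by simpa [dist_eq_norm] using hz)
    exact continuousAt_const.mul (ContinuousAt.comp (f := fun y => z - y) h (by fun_prop))

theorem tendsto_integral_mul_ballOverlap {n : ℕ} {f : Euc n → ℝ} (hf : Integrable f) :
    Tendsto (fun ρ : ℝ => ∫ x, f x * ballOverlap (ρ⁻¹ • x) 0) atTop (𝓝 (∫ x, f x)) := by
  refine tendsto_integral_filter_of_dominated_convergence (fun x => |f x|)
    (.of_forall fun ρ => hf.1.mul
      (continuous_ballOverlap.comp (continuous_const_smul ρ⁻¹)).aestronglyMeasurable)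
    (.of_forall fun ρ => .of_forall fun x => ?_) hf.abs (.of_forall fun x => ?_)
  · rw [Real.norm_eq_abs, abs_mul, abs_of_nonneg (ballOverlap_nonneg _ _)]
    exact mul_le_of_le_one_right (abs_nonneg _) (ballOverlap_le_one _ _)
  · have h : Tendsto (fun ρ : ℝ => ρ⁻¹ • x) atTop (𝓝 0) := by
      simpa using (tendsto_inv_atTop_zero (𝕜 := ℝ)).smul_const x
    simpa [ballOverlap_zero] using ((continuous_ballOverlap.tendsto 0).comp h).const_mul (f x)

theorem IsPosDefKernel.mul_ballOverlap {n : ℕ} {K : Euc n → Euc n → ℝ} (hK : IsPosDefKernel K)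
    (s : ℝ) : IsPosDefKernel fun x y => K x y * ballOverlap (s • x) (s • y) := by
  have h := IsPosDefKernel.integral (μ := volume)
    (K := fun z x y => ballIndicator n z *
      (K x y * (ballIndicator n (z - s • x) * ballIndicator n (z - s • y))))
    (fun z => (hK.mul_diag fun x => ballIndicator n (z - s • x)).const_mul
      (ballIndicator_nonneg z))
    (fun x y => by
      simpa only [mul_left_comm] using (integrable_ballOverlap (s • x) (s • y)).const_mul (K x y))
  convert h.const_mul (inv_nonneg.2 (volume_closedBall_pos (n := n)).le) using 3 with x y
  unfold ballOverlap
  simp_rw [mul_left_comm (ballIndicator n _) (K x y), integral_const_mul]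
  ring

theorem IsPosDefKernel.mul_ballOverlap_sub {n : ℕ} {K : Euc n → Euc n → ℝ}
    (hK : IsPosDefKernel K) (s : ℝ) :
    IsPosDefKernel fun x y => K x y * ballOverlap (s • (x - y)) 0 := by
  have h := IsPosDefKernel.integral (μ := volume)
    (K := fun z x y => K x y * (ballIndicator n (z - s • x) * ballIndicator n (z - s • y)))
    (fun z => hK.mul_diag fun x => ballIndicator n (z - s • x))
    (fun x y => (Integrable.mul_bdd (c := 1) (integrable_ballIndicator.comp_sub_right (s • x))
      (Measurable.aestronglyMeasurable (by fun_prop))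
      (.of_forall fun z => abs_ballIndicator_le _)).const_mul _)
  convert h.const_mul (inv_nonneg.2 (volume_closedBall_pos (n := n)).le) using 3 with x y
  rw [smul_sub, ballOverlap_sub, integral_const_mul]
  ring

/-! ### Positive definite functions and the Fourier transform -/

/-- The integral is, up to a positive factor, the double integral of `h (x - y)` over
`x` and `y` in the unit ball. -/
theorem integral_mul_ballOverlap_nonneg {n : ℕ} {h : Euc n → ℝ} (hc : Continuous h)
    (hi : Integrable h) (hp : IsPosDefKernel fun x y => h (x - y)) :
    0 ≤ ∫ t, h t * ballOverlap t 0 := by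
  have hb : ∀ x, |h x| ≤ h 0 := fun x => by simpa using hp.abs_le x 0
  have hfin : IsFiniteMeasure (volume.restrict (Metric.closedBall (0 : Euc n) 1)) :=
    ⟨by simpa using measure_closedBall_lt_top⟩
  have h0 := hp.integral_prod_nonneg (by fun_prop) (fun x y => hb (x - y))
    (volume.restrict (Metric.closedBall (0 : Euc n) 1))
  rw [integral_prod _ (Integrable.of_bound (Continuous.aestronglyMeasurable (by fun_prop)) (h 0)
    (.of_forall fun p => hb _))] at h0
  have hball : ∀ g : Euc n → ℝ, ∫ x in Metric.closedBall (0 : Euc n) 1, g x =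
      ∫ x, ballIndicator n x * g x := by
    intro g
    rw [← integral_indicator measurableSet_closedBall]
    congr 1 with x
    by_cases hx : x ∈ Metric.closedBall (0 : Euc n) 1 <;> simp [ballIndicator, hx]
  have hinner : ∀ x, ∫ y in Metric.closedBall (0 : Euc n) 1, h (x - y) =
      ∫ t, ballIndicator n (x - t) * h t := by
    intro x
    rw [hball, ← integral_sub_left_eq_self _ volume x]
    simp
  simp_rw [hinner] at h0
  rw [hball] at h0
  simp_rw [← integral_const_mul] at h0
  rw [integral_integral_swap] at h0
  · have : ∀ t, ∫ x, ballIndicator n x * (ballIndicator n (x - t) * h t) =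
        volume.real (Metric.closedBall (0 : Euc n) 1) * (h t * ballOverlap t 0) := by
      intro t
      simp_rw [← mul_assoc]
      rw [integral_mul_const, ballOverlap_zero_right]
      field_simp [volume_closedBall_pos.ne']
    simp_rw [this, integral_const_mul] at h0
    exact nonneg_of_mul_nonneg_right h0 volume_closedBall_pos
  · refine ((integrable_ballIndicator.mul_prod hi).bdd_mul (c := 1)
      (f := fun p : Euc n × Euc n => ballIndicator n (p.1 - p.2))
      (Measurable.aestronglyMeasurable (by fun_prop))
      (.of_forall fun p => abs_ballIndicator_le _)).congr (.of_forall fun p => ?_)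
    simp only [Function.uncurry]
    ring

theorem integral_nonneg_of_isPosDefKernel {n : ℕ} {h : Euc n → ℝ} (hc : Continuous h)
    (hi : Integrable h) (hp : IsPosDefKernel fun x y => h (x - y)) : 0 ≤ ∫ x, h x := by
  refine ge_of_tendsto (tendsto_integral_mul_ballOverlap hi) ?_
  filter_upwards [eventually_gt_atTop 0] with ρ hρ
  have h1 := integral_mul_ballOverlap_nonneg (h := fun x => h (ρ • x)) (by fun_prop)
    (hi.comp_smul hρ.ne') (by simpa only [smul_sub] using hp.comp fun x => ρ • x)
  have h2 := Measure.integral_comp_smul volume (fun x : Euc n => h x * ballOverlap (ρ⁻¹ • x) 0) ρ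
  simp only [inv_smul_smul₀ hρ.ne', smul_eq_mul] at h2
  rw [h2] at h1
  exact nonneg_of_mul_nonneg_right h1 (by positivity)

theorem fourier_ofReal_zero {n : ℕ} (f : Euc n → ℝ) :
    𝓕 (fun x => (f x : ℂ)) (0 : Euc n) = ((∫ x, f x : ℝ) : ℂ) := by
  rw [Real.fourier_eq']
  simp [integral_complex_ofReal]

/-- The easy half of Bochner's theorem. -/
theorem fourier_nonneg_of_isPosDefKernel {n : ℕ} {h : Euc n → ℝ} (hc : Continuous h)
    (hi : Integrable h) (hp : IsPosDefKernel fun x y => h (x - y)) (w : Euc n) :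
    0 ≤ 𝓕 (fun x => (h x : ℂ)) w := by
  have heven : ∀ x, h (-x) = h x := fun x => by simpa using hp.1 0 x
  have hcos : 0 ≤ ∫ x, h x * Real.cos (2 * Real.pi * inner ℝ x w) := by
    refine integral_nonneg_of_isPosDefKernel (by fun_prop)
      (hi.mul_bdd (c := 1) (Continuous.aestronglyMeasurable (by fun_prop))
        (.of_forall fun x => Real.abs_cos_le_one _)) ?_
    simpa only [inner_sub_left, mul_sub] using hp.mul_cos fun x => 2 * Real.pi * inner ℝ x w
  have hsin : ∫ x, h x * Real.sin (2 * Real.pi * inner ℝ x w) = 0 := by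
    have := integral_neg_eq_self (fun x => h x * Real.sin (2 * Real.pi * inner ℝ x w)) volume
    simp only [heven, inner_neg_left, mul_neg, Real.sin_neg, integral_neg] at this
    linarith
  have hcosi : Integrable fun x => ((h x * Real.cos (2 * Real.pi * inner ℝ x w) : ℝ) : ℂ) :=
    (hi.mul_bdd (c := 1) (Continuous.aestronglyMeasurable (by fun_prop))
        (.of_forall fun x => Real.abs_cos_le_one _)).ofReal
  have hsini : Integrable fun x => ((h x * Real.sin (2 * Real.pi * inner ℝ x w) : ℝ) : ℂ) :=
    (hi.mul_bdd (c := 1) (Continuous.aestronglyMeasurable (by fun_prop))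
        (.of_forall fun x => Real.abs_sin_le_one _)).ofReal
  have : 𝓕 (fun x => (h x : ℂ)) w =
      ((∫ x, h x * Real.cos (2 * Real.pi * inner ℝ x w) : ℝ) : ℂ) := by
    rw [Real.fourier_eq']
    have heq : ∀ v : Euc n, Complex.exp (↑(-2 * Real.pi * inner ℝ v w) * Complex.I) • (h v : ℂ) =
        ((h v * Real.cos (2 * Real.pi * inner ℝ v w) : ℝ) : ℂ) -
          ((h v * Real.sin (2 * Real.pi * inner ℝ v w) : ℝ) : ℂ) * Complex.I := by
      intro v
      rw [neg_mul, neg_mul, Complex.ofReal_neg, Complex.exp_mul_I, Complex.cos_neg,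
        Complex.sin_neg, ← Complex.ofReal_cos, ← Complex.ofReal_sin, smul_eq_mul]
      push_cast
      ring
    simp_rw [heq]
    rw [integral_sub hcosi (hsini.mul_const _), integral_mul_const, integral_complex_ofReal,
      integral_complex_ofReal, hsin]
    simp
  rw [this]
  exact Complex.zero_le_real.2 hcos

theorem tendsto_integral_gaussian_mul_fourier {n : ℕ} {f : Euc n → ℂ} (hi : Integrable f)
    (hc : Continuous f) (v : Euc n) :
    Tendsto (fun c : ℝ => ∫ w : Euc n,
      Complex.exp (-(c⁻¹ : ℂ) * ‖w‖ ^ 2 + 2 * Real.pi * Complex.I * inner ℝ v w) • 𝓕 f w)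
      atTop (𝓝 (f v)) := by
  refine (Real.tendsto_integral_gaussian_smul' hi (v := v) hc.continuousAt).congr' ?_
  filter_upwards [Ioi_mem_atTop 0] with c (hc : 0 < c)
  have J : Integrable fun w : Euc n =>
      Complex.exp (-(c⁻¹ : ℂ) * ‖w‖ ^ 2 + 2 * Real.pi * Complex.I * inner ℝ v w) :=
    GaussianFourier.integrable_cexp_neg_mul_sq_norm_add (by
      rw [← Complex.ofReal_inv]; simpa) _ _
  have h : ∫ w : Euc n, 𝓕 (fun w : Euc n =>
        Complex.exp (-(c⁻¹ : ℂ) * ‖w‖ ^ 2 + 2 * Real.pi * Complex.I * inner ℝ v w)) w • f w =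
      ∫ w : Euc n, Complex.exp (-(c⁻¹ : ℂ) * ‖w‖ ^ 2 +
        2 * Real.pi * Complex.I * inner ℝ v w) • 𝓕 f w := by
    simpa using! (VectorFourier.integral_fourierIntegral_smul_eq_flip (L := innerₗ (Euc n))
      Real.continuous_fourierChar continuous_inner J hi)
  rw [← h]
  congr with w
  rw [fourier_gaussian_innerProductSpace' (by rw [← Complex.ofReal_inv]; simpa), div_inv_eq_mul,
    div_inv_eq_mul, mul_right_comm (-(Real.pi : ℂ) ^ 2)]

/-- A continuous integrable function with nonnegative Fourier transform is positive definite: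
it is a limit of superpositions of cosines with Gaussian weights. -/
theorem isPosDefKernel_of_fourier_nonneg {n : ℕ} {f : Euc n → ℝ} (hc : Continuous f)
    (hi : Integrable f) (hF : ∀ w : Euc n, 0 ≤ 𝓕 (fun x => (f x : ℂ)) w) :
    IsPosDefKernel fun x y => f (x - y) := by
  set g : Euc n → ℝ := fun w => (𝓕 (fun x => (f x : ℂ)) w).re with hg
  have hg0 : ∀ w, 0 ≤ g w := fun w => (Complex.le_def.1 (hF w)).1
  have hgF : ∀ w, 𝓕 (fun x => (f x : ℂ)) w = (g w : ℂ) := fun w =>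
    Complex.ext rfl (Complex.le_def.1 (hF w)).2.symm
  have hgc : Continuous g := Complex.continuous_re.comp
    (VectorFourier.fourierIntegral_continuous Real.continuous_fourierChar
      (L := innerₗ (Euc n)) continuous_inner hi.ofReal)
  have hgb : ∀ w, ‖g w‖ ≤ ∫ x, ‖(f x : ℂ)‖ := fun w =>
    (Complex.abs_re_le_norm _).trans
      (VectorFourier.norm_fourierIntegral_le_integral_norm _ _ _ _ _)
  have hexp : ∀ c : ℝ, 0 < c → Integrable fun w : Euc n => Real.exp (-c⁻¹ * ‖w‖ ^ 2) := by
    intro c hc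
    have := (GaussianFourier.integrable_cexp_neg_mul_sq_norm_add (V := Euc n) (b := (c⁻¹ : ℝ))
      (by simpa using hc) 0 0).re
    refine this.congr (.of_forall fun w => ?_)
    simp only [zero_mul, add_zero]
    norm_cast
  have hKi : ∀ c : ℝ, 0 < c → ∀ v : Euc n, Integrable fun w : Euc n =>
      Real.exp (-c⁻¹ * ‖w‖ ^ 2) * g w * Real.cos (2 * Real.pi * inner ℝ v w) := by
    intro c hc v
    refine ((hexp c hc).mul_bdd hgc.aestronglyMeasurable (.of_forall hgb)).mul_bdd (c := 1)
      (Continuous.aestronglyMeasurable (by fun_prop)) (.of_forall fun x => Real.abs_cos_le_one _)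
  have hlim : ∀ v : Euc n, Tendsto (fun c : ℝ => ∫ w : Euc n,
      Real.exp (-c⁻¹ * ‖w‖ ^ 2) * g w * Real.cos (2 * Real.pi * inner ℝ v w))
      atTop (𝓝 (f v)) := by
    intro v
    have h := (Complex.continuous_re.tendsto _).comp (tendsto_integral_gaussian_mul_fourier
      (f := fun x => (f x : ℂ)) hi.ofReal (by fun_prop) v)
    rw [Complex.ofReal_re] at h
    refine h.congr' ?_
    filter_upwards [Ioi_mem_atTop 0] with c (hc : 0 < c)
    have J : Integrable fun w : Euc n =>
        Complex.exp (-(c⁻¹ : ℂ) * ‖w‖ ^ 2 + 2 * Real.pi * Complex.I * inner ℝ v w) •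
          𝓕 (fun x => (f x : ℂ)) w := by
      refine Integrable.mul_bdd (GaussianFourier.integrable_cexp_neg_mul_sq_norm_add (by
        rw [← Complex.ofReal_inv]; simpa) _ _) (c := ∫ x, ‖(f x : ℂ)‖) ?_ (.of_forall fun w =>
          VectorFourier.norm_fourierIntegral_le_integral_norm _ _ _ _ _)
      exact (Complex.continuous_ofReal.comp hgc).aestronglyMeasurable.congr
        (.of_forall fun w => (hgF w).symm)
    refine (integral_re J).symm.trans ?_
    congr 1 with w
    rw [hgF, smul_eq_mul, RCLike.re_eq_complex_re, Complex.re_mul_ofReal, Complex.exp_add,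
      show 2 * (Real.pi : ℂ) * Complex.I * (inner ℝ v w : ℝ) =
        ((2 * Real.pi * inner ℝ v w : ℝ) : ℂ) * Complex.I by push_cast; ring,
      show -(c⁻¹ : ℂ) * (‖w‖ : ℂ) ^ 2 = ((-c⁻¹ * ‖w‖ ^ 2 : ℝ) : ℂ) by push_cast; ring,
      ← Complex.ofReal_exp, Complex.re_ofReal_mul, Complex.exp_ofReal_mul_I_re]
    ring
  refine IsPosDefKernel.of_tendsto (l := atTop) ?_ fun x y => hlim (x - y)
  filter_upwards [Ioi_mem_atTop 0] with c (hc : 0 < c)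
  refine IsPosDefKernel.integral (fun w => ?_) fun x y => hKi c hc (x - y)
  simpa only [inner_sub_left, mul_sub] using (isPosDefKernel_const (n := n)
    (mul_nonneg (Real.exp_pos (-c⁻¹ * ‖w‖ ^ 2)).le (hg0 w))).mul_cos
      fun x => 2 * Real.pi * inner ℝ x w

/-! ### Feasible pairs without normalisation or truncation -/

/-- The constraints of the strengthened bound at `R = ∞`, with the Fourier condition replaced by
positive definiteness of `(x, y) ↦ f₂ (x - y)` and without the normalisation `∫ f₂ = 1`. -/
structure IsFeasiblePair (n : ℕ) (r : ℝ) (f₂ : Euc n → ℝ) (f₃ : Euc n → Euc n → ℝ) : Prop where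
  continuous : Continuous f₂
  integrable : Integrable f₂
  posDef₂ : IsPosDefKernel fun x y => f₂ (x - y)
  posDef₃ : IsPosDefKernel f₃
  two_point : ∀ x : Euc n, r ≤ ‖x‖ → f₂ x + f₃ x 0 + f₃ 0 x + f₃ x x ≤ 0
  three_point : ∀ x y : Euc n, r ≤ ‖x‖ → r ≤ ‖y‖ → r ≤ ‖x - y‖ →
    f₃ x y + f₃ (-x) (y - x) + f₃ (-y) (x - y) ≤ 0

/-- The constraints with finite truncation radius imply those without truncation: a three-point
constraint with a side longer than `R` is vacuous, or is one with two sides at most `R` seen from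
another vertex of the triangle. -/
theorem IsStrengthenedFeasible.isFeasiblePair {n : ℕ} {r : ℝ} {R : EReal} {f₂ : Euc n → ℝ}
    {f₃ : Euc n → Euc n → ℝ} (h : IsStrengthenedFeasible n r R f₂ f₃) :
    IsFeasiblePair n r f₂ f₃ where
  continuous := h.continuous
  integrable := h.integrable
  posDef₂ := isPosDefKernel_of_fourier_nonneg h.continuous h.integrable h.fourier_nonneg
  posDef₃ := h.posDef
  two_point x hx := by
    rcases le_or_gt ((‖x‖ : ℝ) : EReal) R with hR | hR
    · exact h.two_point x hx hR
    · rw [h.vanish x 0 (.inl hR), h.vanish 0 x (.inr hR), h.vanish x x (.inl hR)]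
      simpa using h.two_point_outer x hR.le
  three_point x y hx hy hxy := by
    have key : ∀ x y : Euc n, r ≤ ‖x‖ → r ≤ ‖y‖ → r ≤ ‖x - y‖ → R < (‖x‖ : ℝ) →
        f₃ (-y) (x - y) ≤ 0 := by
      intro x y hx hy hxy hR
      by_cases h1 : R < (‖y‖ : ℝ)
      · rw [h.vanish (-y) _ (.inl (by rwa [norm_neg]))]
      by_cases h2 : R < (‖x - y‖ : ℝ)
      · rw [h.vanish _ (x - y) (.inr h2)]
      have h3 := h.three_point (-y) (x - y) (by rwa [norm_neg]) hxy
        (by rwa [show -y - (x - y) = -x by abel, norm_neg]) (by rw [norm_neg]; exact not_lt.1 h1)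
        (not_lt.1 h2)
      rw [show - -y = y by simp, show x - y - -y = x by abel, show -y - (x - y) = -x by abel,
        h.vanish y x (.inr hR), h.vanish _ (-x) (.inr (by rwa [norm_neg]))] at h3
      linarith
    by_cases h1 : R < (‖x‖ : ℝ)
    · rw [h.vanish x _ (.inl h1), h.vanish (-x) _ (.inl (by rwa [norm_neg]))]
      linarith [key x y hx hy hxy h1]
    by_cases h2 : R < (‖y‖ : ℝ)
    · rw [h.vanish _ y (.inr h2), h.vanish (-y) _ (.inl (by rwa [norm_neg]))]
      linarith [key y x hy hx (by rwa [norm_sub_rev]) h2]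
    exact h.three_point x y hx hy hxy (not_lt.1 h1) (not_lt.1 h2)

theorem IsStrengthenedFeasible.integral_eq_one {n : ℕ} {r : ℝ} {R : EReal} {f₂ : Euc n → ℝ}
    {f₃ : Euc n → Euc n → ℝ} (h : IsStrengthenedFeasible n r R f₂ f₃) : ∫ x, f₂ x = 1 := by
  have := h.fourier_zero
  rw [fourier_ofReal_zero] at this
  exact_mod_cast this

theorem IsFeasiblePair.const_mul {n : ℕ} {r : ℝ} {f₂ : Euc n → ℝ} {f₃ : Euc n → Euc n → ℝ}
    (h : IsFeasiblePair n r f₂ f₃) {a : ℝ} (ha : 0 ≤ a) :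
    IsFeasiblePair n r (fun x => a * f₂ x) (fun x y => a * f₃ x y) where
  continuous := h.continuous.const_mul a
  integrable := h.integrable.const_mul a
  posDef₂ := h.posDef₂.const_mul ha
  posDef₃ := h.posDef₃.const_mul ha
  two_point x hx := by
    simpa only [mul_add, mul_zero] using mul_le_mul_of_nonneg_left (h.two_point x hx) ha
  three_point x y hx hy hxy := by
    simpa only [mul_add, mul_zero] using
      mul_le_mul_of_nonneg_left (h.three_point x y hx hy hxy) ha

theorem IsFeasiblePair.comp_smul {n : ℕ} {r : ℝ} {f₂ : Euc n → ℝ} {f₃ : Euc n → Euc n → ℝ}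
    (h : IsFeasiblePair n r f₂ f₃) {c : ℝ} (hc : 0 < c) :
    IsFeasiblePair n (r / c) (fun x => f₂ (c • x)) (fun x y => f₃ (c • x) (c • y)) where
  continuous := h.continuous.comp (continuous_const_smul c)
  integrable := h.integrable.comp_smul hc.ne'
  posDef₂ := by simpa only [smul_sub] using h.posDef₂.comp fun x => c • x
  posDef₃ := h.posDef₃.comp fun x => c • x
  two_point x hx := by
    have hn : ∀ z : Euc n, r / c ≤ ‖z‖ → r ≤ ‖c • z‖ := fun z hz => by
      rwa [norm_smul, Real.norm_of_nonneg hc.le, ← div_le_iff₀' hc]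
    simpa using h.two_point (c • x) (hn x hx)
  three_point x y hx hy hxy := by
    have hn : ∀ z : Euc n, r / c ≤ ‖z‖ → r ≤ ‖c • z‖ := fun z hz => by
      rwa [norm_smul, Real.norm_of_nonneg hc.le, ← div_le_iff₀' hc]
    simpa [smul_sub] using h.three_point (c • x) (c • y) (hn x hx) (hn y hy)
      (by rw [← smul_sub]; exact hn _ hxy)

/-- Truncation: `f₂ (x - y)` is multiplied by the overlap of the balls of radius `ρ` about `x`
and `y`, and `f₃ x y` by that of the balls about `0`, `x` and `y`. The multipliers agree on the
terms of a two-point or of a three-point constraint, and they preserve positive definiteness. -/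
theorem IsFeasiblePair.truncate {n : ℕ} {r : ℝ} {f₂ : Euc n → ℝ} {f₃ : Euc n → Euc n → ℝ}
    (h : IsFeasiblePair n r f₂ f₃) (s : ℝ) :
    IsFeasiblePair n r (fun x => f₂ x * ballOverlap (s • x) 0)
      (fun x y => f₃ x y * ballOverlap (s • x) (s • y)) where
  continuous := h.continuous.mul (continuous_ballOverlap.comp (continuous_const_smul s))
  integrable := h.integrable.mul_bdd (c := 1)
    (continuous_ballOverlap.comp (continuous_const_smul s)).aestronglyMeasurable
    (.of_forall fun x => by
      rw [Real.norm_of_nonneg (ballOverlap_nonneg _ _)]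
      exact ballOverlap_le_one _ _)
  posDef₂ := h.posDef₂.mul_ballOverlap_sub s
  posDef₃ := h.posDef₃.mul_ballOverlap s
  two_point x hx := by
    rw [smul_zero, ballOverlap_self, ballOverlap_comm 0, ← add_mul, ← add_mul, ← add_mul]
    exact mul_nonpos_of_nonpos_of_nonneg (h.two_point x hx) (ballOverlap_nonneg _ _)
  three_point x y hx hy hxy := by
    rw [smul_neg, smul_neg, smul_sub, smul_sub, ballOverlap_neg_sub, ballOverlap_neg_sub,
      ballOverlap_comm (s • y), ← add_mul, ← add_mul]
    exact mul_nonpos_of_nonpos_of_nonneg (h.three_point x y hx hy hxy) (ballOverlap_nonneg _ _)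

theorem ballOverlap_inv_smul_eq_zero {n : ℕ} {ρ : ℝ} (hρ : 0 < ρ) {x : Euc n}
    (hx : 2 * ρ < ‖x‖) (y : Euc n) : ballOverlap (ρ⁻¹ • x) y = 0 := by
  refine ballOverlap_eq_zero ?_ y
  rwa [norm_smul, Real.norm_of_nonneg (inv_nonneg.2 hρ.le), ← div_eq_inv_mul, lt_div_iff₀ hρ]

theorem IsFeasiblePair.strengthenedBound_le {n : ℕ} {r : ℝ} {R : EReal} {f₂ : Euc n → ℝ}
    {f₃ : Euc n → Euc n → ℝ} (h : IsFeasiblePair n r f₂ f₃) (hI : 0 < ∫ x, f₂ x)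
    (h₂ : ∀ x : Euc n, R ≤ (‖x‖ : ℝ) → f₂ x ≤ 0)
    (h₃ : ∀ x y : Euc n, R < (‖x‖ : ℝ) → f₃ x y = 0) :
    strengthenedBound n r R ≤ ((volume.real (Metric.closedBall (0 : Euc n) (r / 2)) *
      ((f₂ 0 + f₃ 0 0) / ∫ x, f₂ x) : ℝ) : EReal) := by
  have h' := h.const_mul (inv_nonneg.2 hI.le)
  refine sInf_le ⟨fun x => (∫ x, f₂ x)⁻¹ * f₂ x, fun x y => (∫ x, f₂ x)⁻¹ * f₃ x y, ?_, ?_⟩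
  · exact {
      continuous := h'.continuous
      integrable := h'.integrable
      fourier_zero := by
        rw [fourier_ofReal_zero, integral_const_mul, inv_mul_cancel₀ hI.ne', Complex.ofReal_one]
      fourier_nonneg := fourier_nonneg_of_isPosDefKernel h'.continuous h'.integrable h'.posDef₂
      posDef := h'.posDef₃
      vanish := fun x y hxy => by
        rcases hxy with hx | hy
        · rw [h₃ x y hx, mul_zero]
        · rw [h.posDef₃.1, h₃ y x hy, mul_zero]
      two_point := fun x hx _ => h'.two_point x hx
      two_point_outer := fun x hx =>
        mul_nonpos_of_nonneg_of_nonpos (inv_nonneg.2 hI.le) (h₂ x hx)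
      three_point := fun x y hx hy hxy _ _ => h'.three_point x y hx hy hxy }
  · rw [div_eq_inv_mul (f₂ 0 + f₃ 0 0), mul_add (∫ x, f₂ x)⁻¹]

theorem EReal.le_coe_of_tendsto {ι : Type*} {l : Filter ι} [l.NeBot] {a : EReal} {u : ι → ℝ}
    {b : ℝ} (hu : Tendsto u l (𝓝 b)) (h : ∀ᶠ i in l, a ≤ (u i : EReal)) : a ≤ (b : EReal) :=
  ge_of_tendsto ((continuous_coe_real_ereal.tendsto b).comp hu) h

theorem tendsto_div_integral_truncate {n : ℕ} {f₂ : Euc n → ℝ} (hi : Integrable f₂)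
    (hI : 0 < ∫ x, f₂ x) (v a : ℝ) :
    Tendsto (fun ρ : ℝ => v * (a / ∫ x, f₂ x * ballOverlap (ρ⁻¹ • x) 0)) atTop
      (𝓝 (v * (a / ∫ x, f₂ x))) :=
  (tendsto_const_nhds.div (tendsto_integral_mul_ballOverlap hi) hI.ne').const_mul v

theorem IsFeasiblePair.iInf_strengthenedBound_le {n : ℕ} {r : ℝ} (hr : 0 < r) {f₂ : Euc n → ℝ}
    {f₃ : Euc n → Euc n → ℝ} (h : IsFeasiblePair n r f₂ f₃) (hI : 0 < ∫ x, f₂ x) :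
    (⨅ (r : ℝ) (R : ℝ) (_ : 0 < r) (_ : r < R), strengthenedBound n r (R : EReal)) ≤
      ((volume.real (Metric.closedBall (0 : Euc n) (r / 2)) *
        ((f₂ 0 + f₃ 0 0) / ∫ x, f₂ x) : ℝ) : EReal) := by
  refine EReal.le_coe_of_tendsto (tendsto_div_integral_truncate h.integrable hI _ _) ?_
  filter_upwards [eventually_gt_atTop r,
    (tendsto_integral_mul_ballOverlap h.integrable).eventually_const_lt hI] with ρ hρ hpos
  have hρ0 : 0 < ρ := hr.trans hρ
  refine (iInf₂_le r (3 * ρ)).trans ((iInf₂_le hr (by linarith)).trans ?_)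
  have := (h.truncate ρ⁻¹).strengthenedBound_le (R := ((3 * ρ : ℝ) : EReal)) hpos
    (fun x hx => by
      rw [EReal.coe_le_coe_iff] at hx
      rw [ballOverlap_inv_smul_eq_zero hρ0 (by linarith), mul_zero])
    (fun x y hx => by
      rw [EReal.coe_lt_coe_iff] at hx
      rw [ballOverlap_inv_smul_eq_zero hρ0 (by linarith), mul_zero])
  simpa [ballOverlap_zero] using this

/-- Removing the truncation can only lower the bound. -/
theorem strengthenedBound_top_le {n : ℕ} {r : ℝ} (R : EReal) :
    strengthenedBound n r ⊤ ≤ strengthenedBound n r R := by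
  refine le_sInf ?_
  rintro _ ⟨f₂, f₃, h, rfl⟩
  have := h.isFeasiblePair.strengthenedBound_le (R := ⊤) (by simp [h.integral_eq_one])
    (by simp) (by simp)
  simpa [h.integral_eq_one] using this

theorem integral_comp_smul_euc {n : ℕ} (f : Euc n → ℝ) {c : ℝ} (hc : 0 < c) :
    ∫ x, f (c • x) = (∫ x, f x) / c ^ n := by
  rw [Measure.integral_comp_smul, finrank_euclideanSpace_fin, abs_of_pos (by positivity),
    smul_eq_mul, div_eq_inv_mul]

theorem volume_real_closedBall_euc {n : ℕ} {s : ℝ} (hs : 0 ≤ s) :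
    volume.real (Metric.closedBall (0 : Euc n) s) =
      s ^ n * volume.real (Metric.closedBall (0 : Euc n) 1) := by
  rw [Measure.addHaar_real_closedBall _ _ hs, Measure.addHaar_real_closedBall _ _ zero_le_one,
    finrank_euclideanSpace_fin, one_pow, one_mul]

/-! ### The operator `B₃` on small sets -/

/-- The empty set as a point of `I₁`. -/
def IndepSet.empty (n : ℕ) : IndepSet n 1 := ⟨∅, by simp [SimpleGraph.IsIndepSet]⟩

/-- The set `{x}` as a point of `I₁`. -/
def IndepSet.single {n : ℕ} (x : Euc n) : IndepSet n 1 :=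
  ⟨{x}, isIndepSet_singleton x, by simp⟩

theorem IndepSet.eq_empty_or_single {n : ℕ} (J : IndepSet n 1) :
    J = IndepSet.empty n ∨ ∃ x, J = IndepSet.single x := by
  rcases Finset.card_le_one_iff_subset_singleton.1 J.2.2 with ⟨x, hx⟩
  rcases Finset.subset_singleton_iff.1 hx with h | h
  · exact .inl (Subtype.ext h)
  · exact .inr ⟨x, Subtype.ext h⟩

theorem IndepSet.translate_empty {n : ℕ} (z : Euc n) :
    (IndepSet.empty n).translate z = IndepSet.empty n := Subtype.ext (by
  simp [IndepSet.translate, IndepSet.empty])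

theorem IndepSet.translate_single {n : ℕ} (x z : Euc n) :
    (IndepSet.single x).translate z = IndepSet.single (x + z) := Subtype.ext (by
  simp [IndepSet.translate, IndepSet.single])

theorem filter_pair_eq_pair {α : Type*} [DecidableEq α] {a b : α} (hab : a ≠ b) :
    (({a, b} ×ˢ {a, b} : Finset (α × α)).filter
      fun p => {p.1, p.2} ∪ ∅ = ({a, b} : Finset α)) = {(a, b), (b, a)} := by
  ext ⟨x, y⟩
  simp only [Finset.mem_filter, Finset.mem_product, Finset.mem_insert, Finset.mem_singleton,
    Finset.ext_iff, Finset.mem_union, Finset.notMem_empty, or_false, Prod.mk.injEq]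
  constructor
  · rintro ⟨-, h⟩
    have ha := h a
    have hb := h b
    grind
  · rintro (⟨rfl, rfl⟩ | ⟨rfl, rfl⟩) <;> simp [or_comm]

theorem filter_pair_union_eq_pair {α : Type*} [DecidableEq α] {a b : α} (hab : a ≠ b) :
    (({a, b} ×ˢ {a, b} : Finset (α × α)).filter
      fun p => {p.1, p.2} ∪ {a} = ({a, b} : Finset α)) = {(b, b), (a, b), (b, a)} := by
  ext ⟨x, y⟩
  simp only [Finset.mem_filter, Finset.mem_product, Finset.mem_insert, Finset.mem_singleton,
    Finset.ext_iff, Finset.mem_union, Prod.mk.injEq]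
  constructor
  · rintro ⟨hxy, h⟩
    have hb := h b
    grind
  · rintro (⟨rfl, rfl⟩ | ⟨rfl, rfl⟩ | ⟨rfl, rfl⟩) <;> simp <;> tauto

theorem filter_pair_eq_triple {α : Type*} [DecidableEq α] {a b c : α} (hab : a ≠ b)
    (hac : a ≠ c) (hbc : b ≠ c) :
    (({a, b, c} ×ˢ {a, b, c} : Finset (α × α)).filter
      fun p => {p.1, p.2} ∪ ∅ = ({a, b, c} : Finset α)) = ∅ := by
  refine Finset.filter_eq_empty_iff.2 fun p _ h => ?_
  have h3 : ({a, b, c} : Finset α).card = 3 := by simp [*]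
  have := Finset.card_le_two (a := p.1) (b := p.2)
  rw [Finset.union_empty] at h
  rw [h] at this
  omega

theorem filter_pair_union_eq_triple {α : Type*} [DecidableEq α] {a b c : α} (hab : a ≠ b)
    (hac : a ≠ c) (hbc : b ≠ c) :
    (({a, b, c} ×ˢ {a, b, c} : Finset (α × α)).filter
      fun p => {p.1, p.2} ∪ {a} = ({a, b, c} : Finset α)) = {(b, c), (c, b)} := by
  ext ⟨x, y⟩
  simp only [Finset.mem_filter, Finset.mem_product, Finset.mem_insert, Finset.mem_singleton,
    Finset.ext_iff, Finset.mem_union, Prod.mk.injEq]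
  constructor
  · rintro ⟨hxy, h⟩
    have hb := h b
    have hc := h c
    grind
  · rintro (⟨rfl, rfl⟩ | ⟨rfl, rfl⟩) <;> simp <;> tauto

open Classical in
/-- The sum defining `B₃`, organised by the set `J`. -/
theorem opB_three {n : ℕ} (T : Euc n × Euc n × IndepSet n (3 - 2) → ℝ) (S : Finset (Euc n))
    (hS : (packingGraph n).IsIndepSet (S : Set (Euc n))) :
    opB 3 T S hS =
      (∑ p ∈ (S ×ˢ S).filter (fun p => {p.1, p.2} ∪ ∅ = S), T (p.1, p.2, IndepSet.empty n)) +
      ∑ a ∈ S, ∑ p ∈ (S ×ˢ S).filter (fun p => {p.1, p.2} ∪ {a} = S),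
        T (p.1, p.2, IndepSet.single a) := by
  let F : Finset (Euc n) → ℝ := fun J =>
    ∑ p ∈ (S ×ˢ S).filter (fun p => {p.1, p.2} ∪ J = S),
      if h : (packingGraph n).IsIndepSet (J : Set (Euc n)) ∧ J.card ≤ 1 then
        T (p.1, p.2, ⟨J, h⟩) else 0
  have h1 : opB 3 T S hS = ∑ J ∈ S.powerset.filter (fun J => J.card ≤ 1), F J := by
    rw [← Finset.sum_attach]
    refine Finset.sum_congr rfl fun J _ => Finset.sum_congr rfl fun p _ => ?_
    have h := J.2
    rw [Finset.mem_filter, Finset.mem_powerset] at h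
    rw [dif_pos ⟨hS.mono (Finset.coe_subset.2 h.1), h.2⟩]
  have h2 : S.powerset.filter (fun J => J.card ≤ 1) = insert ∅ (S.image fun a => {a}) := by
    ext J
    simp only [Finset.mem_filter, Finset.mem_powerset, Finset.mem_insert, Finset.mem_image]
    constructor
    · rintro ⟨hJ, hc⟩
      rcases Finset.card_le_one_iff_subset_singleton.1 hc with ⟨x, hx⟩
      rcases Finset.subset_singleton_iff.1 hx with rfl | rfl
      · exact .inl rfl
      · exact .inr ⟨x, hJ (Finset.mem_singleton_self x), rfl⟩
    · rintro (rfl | ⟨x, hx, rfl⟩)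
      · simp
      · simpa using hx
  rw [h1, h2, Finset.sum_insert (by simp), Finset.sum_image (by simp)]
  refine congrArg₂ (· + ·) ?_ ?_
  · exact Finset.sum_congr rfl fun p _ => dif_pos (IndepSet.empty n).2
  · exact Finset.sum_congr rfl fun a _ => Finset.sum_congr rfl fun p _ =>
      dif_pos (IndepSet.single a).2

theorem opB_three_singleton {n : ℕ} (T : Euc n × Euc n × IndepSet n (3 - 2) → ℝ) (a : Euc n)
    (hS : (packingGraph n).IsIndepSet (({a} : Finset (Euc n)) : Set (Euc n))) :
    opB 3 T {a} hS = T (a, a, IndepSet.empty n) + T (a, a, IndepSet.single a) := by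
  rw [opB_three]
  simp [Finset.filter_singleton]

open Classical in
theorem opB_three_pair {n : ℕ} (T : Euc n × Euc n × IndepSet n (3 - 2) → ℝ) {a b : Euc n}
    (hab : a ≠ b)
    (hS : (packingGraph n).IsIndepSet (({a, b} : Finset (Euc n)) : Set (Euc n))) :
    opB 3 T {a, b} hS = (T (a, b, IndepSet.empty n) + T (b, a, IndepSet.empty n)) +
      ((T (b, b, IndepSet.single a) + T (a, b, IndepSet.single a) +
          T (b, a, IndepSet.single a)) +
        (T (a, a, IndepSet.single b) + T (a, b, IndepSet.single b) +
          T (b, a, IndepSet.single b))) := by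
  have h2 := filter_pair_union_eq_pair hab.symm
  rw [Finset.pair_comm] at h2
  rw [opB_three, Finset.sum_pair hab, filter_pair_eq_pair hab, filter_pair_union_eq_pair hab, h2,
    Finset.sum_pair (by simp [hab]), Finset.sum_insert (by simp [hab.symm]),
    Finset.sum_pair (by simp [hab]), Finset.sum_insert (by simp [hab]),
    Finset.sum_pair (by simp [hab.symm])]
  ring

open Classical in
theorem opB_three_triple {n : ℕ} (T : Euc n × Euc n × IndepSet n (3 - 2) → ℝ) {a b c : Euc n}
    (hab : a ≠ b) (hac : a ≠ c) (hbc : b ≠ c)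
    (hS : (packingGraph n).IsIndepSet (({a, b, c} : Finset (Euc n)) : Set (Euc n))) :
    opB 3 T {a, b, c} hS = (T (b, c, IndepSet.single a) + T (c, b, IndepSet.single a)) +
      ((T (a, c, IndepSet.single b) + T (c, a, IndepSet.single b)) +
        (T (a, b, IndepSet.single c) + T (b, a, IndepSet.single c))) := by
  have h2 := filter_pair_union_eq_triple hab.symm hbc hac
  have h3 := filter_pair_union_eq_triple hac.symm hbc.symm hab
  rw [show ({b, a, c} : Finset (Euc n)) = {a, b, c} from Finset.insert_comm b a {c}] at h2
  rw [show ({c, a, b} : Finset (Euc n)) = {a, b, c} by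
    rw [Finset.insert_comm, Finset.pair_comm]] at h3
  rw [opB_three, Finset.sum_insert (by simp [hab, hac]), Finset.sum_pair hbc,
    filter_pair_eq_triple hab hac hbc, filter_pair_union_eq_triple hab hac hbc, h2, h3,
    Finset.sum_pair (by simp [hbc]), Finset.sum_pair (by simp [hac]),
    Finset.sum_pair (by simp [hab]), Finset.sum_empty, zero_add]

/-! ### From the three-point bound to feasible pairs -/

theorem isIndepSet_packingGraph_iff {n : ℕ} {S : Set (Euc n)} :
    (packingGraph n).IsIndepSet S ↔ ∀ a ∈ S, ∀ b ∈ S, a ≠ b → 2 ≤ ‖a - b‖ := by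
  refine forall₂_congr fun a _ => forall₂_congr fun b _ => forall_congr' fun hab => ?_
  have : 0 < ‖a - b‖ := norm_pos_iff.2 (sub_ne_zero.2 hab)
  simp only [packingGraph, this, true_and, not_lt]

open Classical in
theorem isIndepSet_pair {n : ℕ} {a b : Euc n} (hab : 2 ≤ ‖a - b‖) :
    (packingGraph n).IsIndepSet (({a, b} : Finset (Euc n)) : Set (Euc n)) := by
  have hba : 2 ≤ ‖b - a‖ := by rwa [norm_sub_rev]
  rw [isIndepSet_packingGraph_iff]
  simp [hab, hba]

open Classical in
theorem isIndepSet_triple {n : ℕ} {a b c : Euc n} (hab : 2 ≤ ‖a - b‖) (hac : 2 ≤ ‖a - c‖)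
    (hbc : 2 ≤ ‖b - c‖) :
    (packingGraph n).IsIndepSet (({a, b, c} : Finset (Euc n)) : Set (Euc n)) := by
  have hba : 2 ≤ ‖b - a‖ := by rwa [norm_sub_rev]
  have hca : 2 ≤ ‖c - a‖ := by rwa [norm_sub_rev]
  have hcb : 2 ≤ ‖c - b‖ := by rwa [norm_sub_rev]
  rw [isIndepSet_packingGraph_iff]
  simp [hab, hba, hac, hca, hbc, hcb]

theorem IsKPointFeasible.apply_single {n : ℕ} {f : Euc n × Euc n × IndepSet n (3 - 2) → ℝ}
    (h : IsKPointFeasible n 3 f) (x y z : Euc n) :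
    f (x, y, IndepSet.single z) = f (x - z, y - z, IndepSet.single 0) := by
  have := h.translation_invariant x y (-z) (IndepSet.single z)
  rwa [IndepSet.translate_single, add_neg_cancel, ← sub_eq_add_neg, ← sub_eq_add_neg] at this

theorem IsKPointFeasible.apply_empty {n : ℕ} {f : Euc n × Euc n × IndepSet n (3 - 2) → ℝ}
    (h : IsKPointFeasible n 3 f) (x y : Euc n) :
    f (x, y, IndepSet.empty n) = f (x - y, 0, IndepSet.empty n) := by
  have := h.translation_invariant x y (-y) (IndepSet.empty n)
  rwa [IndepSet.translate_empty, add_neg_cancel, ← sub_eq_add_neg] at this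

/-- A feasible function of the three-point bound gives a feasible pair at distance `2`. Since
`B₃ f {0, x}` only sees the sum of the two-point constraints at `x` and `-x`, the kernel is
averaged over the reflection `x ↦ -x`. -/
theorem IsKPointFeasible.isFeasiblePair {n : ℕ} {f : Euc n × Euc n × IndepSet n (3 - 2) → ℝ}
    (h : IsKPointFeasible n 3 f) :
    IsFeasiblePair n 2 (fun x => f (x, 0, IndepSet.empty n))
      (fun x y => 2⁻¹ * (f (x, y, IndepSet.single 0) + f (-x, -y, IndepSet.single 0))) where
  continuous := h.continuous.comp (by fun_prop)
  integrable := h.integrable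
  posDef₂ := by simpa only [← h.apply_empty] using h.posDef (IndepSet.empty n)
  posDef₃ := ((h.posDef (IndepSet.single 0)).add
    ((h.posDef (IndepSet.single 0)).comp fun x => -x)).const_mul (by norm_num)
  two_point x hx := by
    classical
    have hx0 : (0 : Euc n) ≠ x := by
      rintro rfl
      norm_num at hx
    have hS := isIndepSet_pair (a := 0) (b := x) (by simpa using hx)
    have hB := h.opB_nonpos {0, x} hS (by rw [Finset.card_pair hx0])
      (by rw [Finset.card_pair hx0]; norm_num)
    have hs : f (0, x, IndepSet.empty n) = f (x, 0, IndepSet.empty n) :=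
      (h.posDef (IndepSet.empty n)).1 0 x
    rw [opB_three_pair f hx0 hS, hs] at hB
    simp only [h.apply_single _ _ x, zero_sub, sub_self] at hB
    rw [neg_zero]
    linarith
  three_point x y hx hy hxy := by
    classical
    have key : ∀ x y : Euc n, 2 ≤ ‖x‖ → 2 ≤ ‖y‖ → 2 ≤ ‖x - y‖ →
        f (x, y, IndepSet.single 0) + f (-x, y - x, IndepSet.single 0) +
          f (-y, x - y, IndepSet.single 0) ≤ 0 := by
      intro x y hx hy hxy
      have h1 : (0 : Euc n) ≠ x := by
        rintro rfl
        norm_num at hx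
      have h2 : (0 : Euc n) ≠ y := by
        rintro rfl
        norm_num at hy
      have h3 : x ≠ y := by
        rintro rfl
        norm_num at hxy
      have hS := isIndepSet_triple (a := 0) (by simpa using hx) (by simpa using hy) hxy
      have hc : ({0, x, y} : Finset (Euc n)).card = 3 := by simp [*]
      have hB := h.opB_nonpos {0, x, y} hS (by omega) (by omega)
      rw [opB_three_triple f h1 h2 h3 hS] at hB
      simp only [h.apply_single _ _ x, h.apply_single _ _ y, zero_sub] at hB
      have hs := fun x y => (h.posDef (IndepSet.single 0)).1 x y
      simp only at hs
      rw [hs y x, hs (y - x), hs (x - y)] at hB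
      linarith
    have h1 := key x y hx hy hxy
    have h2 := key (-x) (-y) (by rwa [norm_neg]) (by rwa [norm_neg])
      (by rwa [neg_sub_neg, norm_sub_rev])
    rw [neg_sub_neg, neg_sub_neg] at h2
    rw [neg_sub, neg_sub]
    linarith

theorem kPointBound_three_le_of_forall {n : ℕ} {a : EReal}
    (ha : ∀ (f₂ : Euc n → ℝ) (f₃ : Euc n → Euc n → ℝ), IsFeasiblePair n 2 f₂ f₃ →
      ∫ x, f₂ x = 1 →
      a ≤ ((volume.real (Metric.closedBall (0 : Euc n) 1) * (f₂ 0 + f₃ 0 0) : ℝ) : EReal)) :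
    a ≤ kPointBound 3 n := by
  refine le_sInf ?_
  rintro _ ⟨f, hf, rfl⟩
  refine (ha _ _ hf.isFeasiblePair hf.integral_eq_one).trans_eq ?_
  rw [opB_three_singleton, neg_zero, ← two_mul, inv_mul_cancel_left₀ two_ne_zero]

theorem strengthenedBound_top_le_kPointBound {n : ℕ} {r : ℝ} (hr : 0 < r) :
    strengthenedBound n r ⊤ ≤ kPointBound 3 n := by
  refine kPointBound_three_le_of_forall fun f₂ f₃ h hI => ?_
  have hc : 0 < 2 / r := by positivity
  have hint := integral_comp_smul_euc f₂ hc
  have := (h.comp_smul hc).strengthenedBound_le (R := ⊤) (by rw [hint, hI]; positivity)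
    (by simp) (by simp)
  rw [div_div_cancel₀ two_ne_zero] at this
  refine this.trans_eq ?_
  rw [hint, hI, volume_real_closedBall_euc (by positivity : 0 ≤ r / 2), smul_zero,
    EReal.coe_eq_coe_iff, div_div_eq_mul_div, div_one]
  have : (r / 2) ^ n * (2 / r) ^ n = 1 := by
    rw [← mul_pow, div_mul_div_cancel₀ two_ne_zero, div_self hr.ne', one_pow]
  linear_combination volume.real (Metric.closedBall (0 : Euc n) 1) * (f₂ 0 + f₃ 0 0) * this

theorem iInf_strengthenedBound_le_kPointBound {n : ℕ} :
    (⨅ (r : ℝ) (R : ℝ) (_ : 0 < r) (_ : r < R), strengthenedBound n r (R : EReal)) ≤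
      kPointBound 3 n := by
  refine kPointBound_three_le_of_forall fun f₂ f₃ h hI => ?_
  have := h.iInf_strengthenedBound_le two_pos (by simp [hI])
  simpa [hI] using this

/-! ### Rounding to a randomly shifted grid -/

/-- The representative in `[0, 1)` of an element of `ℝ / ℤ`. -/
noncomputable def circleFract (a : UnitAddCircle) : ℝ := (AddCircle.equivIco 1 0 a : ℝ)

theorem circleFract_nonneg (a : UnitAddCircle) : 0 ≤ circleFract a :=
  (AddCircle.equivIco 1 0 a).2.1

theorem circleFract_le_one (a : UnitAddCircle) : circleFract a ≤ 1 :=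
  (AddCircle.equivIco 1 0 a).2.2.le.trans_eq (zero_add 1)

theorem coe_circleFract (a : UnitAddCircle) : (circleFract a : UnitAddCircle) = a :=
  AddCircle.coe_equivIco

@[fun_prop]
theorem measurable_circleFract : Measurable circleFract :=
  measurable_subtype_coe.comp (AddCircle.measurableEquivIco 1 0).measurable

theorem continuousAt_circleFract {a : UnitAddCircle} (ha : a ≠ 0) : ContinuousAt circleFract a :=
  continuousAt_subtype_val.comp (AddCircle.continuousAt_equivIco 1 0 (by simpa using ha))

/-- The uniform distribution of the shift of the grid. -/
noncomputable def shiftMeasure (n : ℕ) : Measure (Fin n → UnitAddCircle) :=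
  Measure.pi fun _ => AddCircle.haarAddCircle

instance (n : ℕ) : IsProbabilityMeasure (shiftMeasure n) := by
  unfold shiftMeasure
  infer_instance

instance (n : ℕ) : (shiftMeasure n).IsAddRightInvariant := by
  unfold shiftMeasure
  infer_instance

theorem ae_shiftMeasure_ne {n : ℕ} (i : Fin n) (a : UnitAddCircle) :
    ∀ᵐ u ∂shiftMeasure n, u i ≠ a := by
  have : Nontrivial (Set.Ico (0 : ℝ) (0 + 1)) :=
    ⟨⟨0, by norm_num⟩, ⟨1 / 2, by norm_num⟩, by norm_num⟩
  have : Nontrivial UnitAddCircle := (AddCircle.equivIco (1 : ℝ) 0).nontrivial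
  exact measure_eq_zero_iff_ae_notMem.1 
    (Measure.pi_hyperplane (fun _ : Fin n => AddCircle.haarAddCircle) i a)

/-- Rounding down, in each coordinate, to the grid of mesh `ε` shifted by `-ε u`. The shift `u`
is taken modulo the grid, so that the rounded point is `x` minus a fractional part. -/
noncomputable def gridRound {n : ℕ} (ε : ℝ) (u : Fin n → UnitAddCircle) (x : Euc n) : Euc n :=
  WithLp.toLp 2 fun i => x i - ε * circleFract ((x i / ε : ℝ) + u i)

theorem gridRound_add {n : ℕ} (ε : ℝ) (u : Fin n → UnitAddCircle) (x v : Euc n) :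
    gridRound ε u (x + v) = gridRound ε (u + fun i => ((v i / ε : ℝ) : UnitAddCircle)) x + v := by
  ext i
  simp only [gridRound, PiLp.add_apply, Pi.add_apply, add_div, AddCircle.coe_add]
  rw [add_assoc, add_comm (u i)]
  ring

theorem norm_gridRound_sub_le {n : ℕ} {ε : ℝ} (hε : 0 ≤ ε) (u : Fin n → UnitAddCircle)
    (x : Euc n) : ‖gridRound ε u x - x‖ ≤ ε * √n := by
  rw [EuclideanSpace.norm_eq]
  refine Real.sqrt_le_iff.2 ⟨by positivity, ?_⟩
  rw [mul_pow, Real.sq_sqrt (Nat.cast_nonneg n)]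
  calc ∑ i, ‖(gridRound ε u x - x) i‖ ^ 2 ≤ ∑ _i : Fin n, ε ^ 2 := by
        refine Finset.sum_le_sum fun i _ => ?_
        have h : (gridRound ε u x - x) i = -(ε * circleFract ((x i / ε : ℝ) + u i)) := by
          simp [gridRound]
        rw [h, norm_neg, Real.norm_of_nonneg (mul_nonneg hε (circleFract_nonneg _))]
        have := mul_le_of_le_one_right hε (circleFract_le_one ((x i / ε : ℝ) + u i))
        exact pow_le_pow_left₀ (mul_nonneg hε (circleFract_nonneg _)) this 2
    _ = ε ^ 2 * n := by simp [mul_comm]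

theorem norm_gridRound_sub_gridRound_sub_le {n : ℕ} {ε : ℝ} (hε : 0 ≤ ε)
    (u : Fin n → UnitAddCircle) (x y : Euc n) :
    ‖(gridRound ε u x - gridRound ε u y) - (x - y)‖ ≤ 2 * ε * √n := by
  have hx := norm_gridRound_sub_le hε u x
  have hy := norm_gridRound_sub_le hε u y
  calc ‖(gridRound ε u x - gridRound ε u y) - (x - y)‖
      = ‖(gridRound ε u x - x) - (gridRound ε u y - y)‖ := by congr 1; abel
    _ ≤ _ := norm_sub_le _ _
    _ ≤ _ := by linarith

/-- The lattice `ε ℤⁿ`. -/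
def gridLattice (n : ℕ) (ε : ℝ) : Set (Euc n) := {a | ∀ i, ∃ k : ℤ, a i = ε * k}

theorem gridRound_sub_mem {n : ℕ} {ε : ℝ} (hε : ε ≠ 0) (u : Fin n → UnitAddCircle)
    (x y : Euc n) : gridRound ε u x - gridRound ε u y ∈ gridLattice n ε := by
  intro i
  set p := circleFract ((x i / ε : ℝ) + u i) with hp
  set q := circleFract ((y i / ε : ℝ) + u i) with hq
  have h : ((x i / ε - p - (y i / ε - q) : ℝ) : UnitAddCircle) = 0 := by
    simp only [AddCircle.coe_sub, hp, hq, coe_circleFract]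
    abel
  obtain ⟨k, hk⟩ := AddCircle.coe_eq_zero_iff 1 |>.1 h
  refine ⟨k, ?_⟩
  have hk' : (k : ℝ) = x i / ε - p - (y i / ε - q) := by simpa using hk
  rw [hk']
  simp only [gridRound, PiLp.sub_apply, ← hp, ← hq]
  field_simp

theorem gridLattice_eq_range (n : ℕ) (ε : ℝ) : gridLattice n ε =
    Set.range fun k : Fin n → ℤ => (WithLp.toLp 2 fun i => ε * (k i : ℝ) : Euc n) := by
  ext a
  constructor
  · intro h
    choose k hk using h
    exact ⟨k, by ext i; simp [hk]⟩
  · rintro ⟨k, rfl⟩ i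
    exact ⟨k i, by simp⟩

theorem countable_gridLattice (n : ℕ) (ε : ℝ) : (gridLattice n ε).Countable := by
  rw [gridLattice_eq_range]
  exact Set.countable_range _

theorem finite_gridLattice_inter {n : ℕ} {ε : ℝ} (hε : 0 < ε) (ρ : ℝ) :
    (gridLattice n ε ∩ Metric.closedBall 0 ρ).Finite := by
  refine (((Set.finite_Icc (fun _ : Fin n => -⌈ρ / ε⌉) fun _ => ⌈ρ / ε⌉)).image
    fun k : Fin n → ℤ => (WithLp.toLp 2 fun i => ε * (k i : ℝ) : Euc n)).subset ?_
  rintro a ⟨ha, hρ⟩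
  rw [gridLattice_eq_range] at ha
  obtain ⟨k, rfl⟩ := ha
  have hk : ∀ i, |k i| ≤ ⌈ρ / ε⌉ := by
    intro i
    have h1 := (PiLp.norm_apply_le (WithLp.toLp 2 fun i => ε * (k i : ℝ) : Euc n) i).trans
      (mem_closedBall_zero_iff.1 hρ)
    rw [Real.norm_eq_abs, abs_mul, abs_of_pos hε, ← le_div_iff₀' hε] at h1
    exact_mod_cast h1.trans (Int.le_ceil _)
  exact ⟨k, ⟨fun i => (abs_le.1 (hk i)).1, fun i => (abs_le.1 (hk i)).2⟩, rfl⟩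

theorem eq_zero_of_mem_gridLattice {n : ℕ} {ε : ℝ} (hε : 0 < ε) {a : Euc n}
    (ha : a ∈ gridLattice n ε) (h : ‖a‖ < ε) : a = 0 := by
  ext i
  obtain ⟨k, hk⟩ := ha i
  have h1 := (PiLp.norm_apply_le a i).trans_lt h
  rw [hk, Real.norm_eq_abs, abs_mul, abs_of_pos hε, mul_lt_iff_lt_one_right hε] at h1
  have : k = 0 := Int.abs_lt_one_iff.1 (by exact_mod_cast h1)
  simp [hk, this]

@[fun_prop]
theorem measurable_gridRound {n : ℕ} (ε : ℝ) (x : Euc n) :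
    Measurable fun u => gridRound ε u x := by
  unfold gridRound
  refine (MeasurableEquiv.toLp 2 (Fin n → ℝ)).measurable.comp (measurable_pi_lambda _ fun i => ?_)
  fun_prop

/-- For almost every shift the rounding is locally constant at a given point. -/
theorem ae_eventually_gridRound_eq {n : ℕ} {ε : ℝ} (hε : 0 < ε) (x : Euc n) :
    ∀ᵐ u ∂shiftMeasure n, ∀ᶠ y in 𝓝 x, gridRound ε u y = gridRound ε u x := by
  have h : ∀ i, ∀ᵐ u ∂shiftMeasure n, u i ≠ -((x i / ε : ℝ) : UnitAddCircle) := fun i =>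
    ae_shiftMeasure_ne i _
  filter_upwards [ae_all_iff.2 h] with u hu
  -- Rounded points differ by lattice vectors, so continuity at `x` forces local constancy.
  have hc : ContinuousAt (gridRound ε u) x := by
    unfold gridRound
    refine (PiLp.continuous_toLp 2 _).continuousAt.comp (continuousAt_pi.2 fun i => ?_)
    have h1 : ContinuousAt (fun y : Euc n => ((y i / ε : ℝ) : UnitAddCircle) + u i) x := by
      refine Continuous.continuousAt ?_
      exact ((AddCircle.continuous_mk' 1).comp (by fun_prop)).add continuous_const
    have h2 : ContinuousAt
        (fun y : Euc n => circleFract (((y i / ε : ℝ) : UnitAddCircle) + u i)) x :=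
      ContinuousAt.comp (f := fun y : Euc n => ((y i / ε : ℝ) : UnitAddCircle) + u i)
        (continuousAt_circleFract fun h0 => hu i (eq_neg_of_add_eq_zero_right h0)) h1
    exact ContinuousAt.sub (by fun_prop) (h2.const_mul ε)
  filter_upwards [Metric.continuousAt_iff'.1 hc ε hε] with y hy
  rw [dist_eq_norm] at hy
  exact sub_eq_zero.1 (eq_zero_of_mem_gridLattice hε (gridRound_sub_mem hε.ne' u y x) hy)

/-- No regularity of `H` is needed: its arguments range over a countable set. -/
theorem aestronglyMeasurable_gridRound {n : ℕ} {ε : ℝ} (hε : ε ≠ 0) (H : Euc n → Euc n → ℝ)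
    (x y z : Euc n) : AEStronglyMeasurable (fun u =>
      H (gridRound ε u x - gridRound ε u z) (gridRound ε u y - gridRound ε u z))
      (shiftMeasure n) := by
  have hm : Measurable fun u => (gridRound ε u x - gridRound ε u z,
      gridRound ε u y - gridRound ε u z) := by fun_prop
  have hcount : (gridLattice n ε ×ˢ gridLattice n ε).Countable :=
    (countable_gridLattice n ε).prod (countable_gridLattice n ε)
  refine Measurable.aestronglyMeasurable fun s _ => ?_
  have : (fun u => H (gridRound ε u x - gridRound ε u z)
      (gridRound ε u y - gridRound ε u z)) ⁻¹' s =
      (fun u => (gridRound ε u x - gridRound ε u z, gridRound ε u y - gridRound ε u z)) ⁻¹'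
        ((gridLattice n ε ×ˢ gridLattice n ε) ∩ {p | H p.1 p.2 ∈ s}) := by
    ext u
    simp [gridRound_sub_mem hε]
  rw [this]
  exact hm (hcount.mono Set.inter_subset_left).measurableSet

theorem exists_bound_gridRound {n : ℕ} {ε : ℝ} (hε : 0 < ε) (H : Euc n → Euc n → ℝ) (ρ : ℝ) :
    ∃ M, ∀ x y z : Euc n, ‖x - z‖ ≤ ρ → ‖y - z‖ ≤ ρ → ∀ u : Fin n → UnitAddCircle,
      ‖H (gridRound ε u x - gridRound ε u z) (gridRound ε u y - gridRound ε u z)‖ ≤ M := by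
  have hfin := finite_gridLattice_inter (n := n) hε (ρ + 2 * ε * √n)
  obtain ⟨M, hM⟩ := ((hfin.prod hfin).image fun p => ‖H p.1 p.2‖).bddAbove
  have hmem : ∀ x z : Euc n, ‖x - z‖ ≤ ρ → ∀ u : Fin n → UnitAddCircle,
      gridRound ε u x - gridRound ε u z ∈
        gridLattice n ε ∩ Metric.closedBall 0 (ρ + 2 * ε * √n) := by
    refine fun x z h u => ⟨gridRound_sub_mem hε.ne' u x z, mem_closedBall_zero_iff.2 ?_⟩
    have h1 := norm_gridRound_sub_gridRound_sub_le hε.le u x z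
    have h2 := norm_le_norm_add_norm_sub' (gridRound ε u x - gridRound ε u z) (x - z)
    linarith
  exact ⟨M, fun x y z hx hy u =>
    hM (Set.mem_image_of_mem _ (Set.mk_mem_prod (hmem x z hx u) (hmem y z hy u)))⟩

theorem integrable_gridRound {n : ℕ} {ε : ℝ} (hε : 0 < ε) (H : Euc n → Euc n → ℝ)
    (x y z : Euc n) : Integrable (fun u =>
      H (gridRound ε u x - gridRound ε u z) (gridRound ε u y - gridRound ε u z))
      (shiftMeasure n) := by
  obtain ⟨M, hM⟩ := exists_bound_gridRound hε H (max ‖x - z‖ ‖y - z‖)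
  exact Integrable.of_bound (aestronglyMeasurable_gridRound hε.ne' H x y z) M
    (.of_forall fun u => hM x y z (le_max_left _ _) (le_max_right _ _) u)

/-- Averaging over the shift makes every function of differences of rounded points continuous. -/
theorem continuous_integral_gridRound {n : ℕ} {ε : ℝ} (hε : 0 < ε) (H : Euc n → Euc n → ℝ) :
    Continuous fun p : Euc n × Euc n × Euc n => ∫ u,
      H (gridRound ε u p.1 - gridRound ε u p.2.2) (gridRound ε u p.2.1 - gridRound ε u p.2.2)
        ∂shiftMeasure n := by
  refine continuous_iff_continuousAt.2 fun p => ?_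
  set ρ := max ‖p.1 - p.2.2‖ ‖p.2.1 - p.2.2‖ + 1 with hρ
  obtain ⟨M, hM⟩ := exists_bound_gridRound hε H ρ
  have h1 : ∀ᶠ q : Euc n × Euc n × Euc n in 𝓝 p, ‖q.1 - q.2.2‖ < ρ :=
    (Continuous.tendsto (by fun_prop) p).eventually_lt_const
      ((le_max_left _ _).trans_lt (lt_add_one _))
  have h2 : ∀ᶠ q : Euc n × Euc n × Euc n in 𝓝 p, ‖q.2.1 - q.2.2‖ < ρ :=
    (Continuous.tendsto (by fun_prop) p).eventually_lt_const
      ((le_max_right _ _).trans_lt (lt_add_one _))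
  refine continuousAt_of_dominated (bound := fun _ => M)
    (.of_forall fun q => aestronglyMeasurable_gridRound hε.ne' H _ _ _) ?_ (integrable_const M) ?_
  · filter_upwards [h1, h2] with q hq1 hq2
    exact .of_forall fun u => hM _ _ _ hq1.le hq2.le u
  · filter_upwards [ae_eventually_gridRound_eq hε p.1, ae_eventually_gridRound_eq hε p.2.1,
      ae_eventually_gridRound_eq hε p.2.2] with u hu1 hu2 hu3
    refine (continuousAt_const (y := H (gridRound ε u p.1 - gridRound ε u p.2.2)
      (gridRound ε u p.2.1 - gridRound ε u p.2.2))).congr ?_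
    filter_upwards [continuousAt_fst.eventually hu1,
      (continuousAt_fst.comp continuousAt_snd).eventually hu2,
      (continuousAt_snd.comp continuousAt_snd).eventually hu3] with q hq1 hq2 hq3
    simp only [Function.comp_apply] at hq2 hq3
    rw [hq1, hq2, hq3]

/-! ### From feasible pairs to the three-point bound -/

/-- The empty set is isolated in `I₁`. -/
theorem IndepSet.continuous_of_single {n : ℕ} {X : Type*} [TopologicalSpace X]
    {g : IndepSet n 1 → X} (h : Continuous fun x : Euc n => g (IndepSet.single x)) :
    Continuous g := by
  refine continuous_iSup_dom.2 fun j => continuous_coinduced_dom.2 ?_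
  fin_cases j
  · refine continuous_of_const fun v w => congrArg g (Subtype.ext ?_)
    simp [IndepSet.ofTuple]
  · refine (h.comp ((continuous_apply (0 : Fin 1)).comp continuous_subtype_val)).congr fun v => ?_
    refine congrArg g (Subtype.ext ?_)
    simp [IndepSet.ofTuple, IndepSet.single]

/-- The function on `ℝⁿ × ℝⁿ × I₁` which is `f₂ (x - y)` at `J = ∅` and `f₃ (x - z) (y - z)` at
`J = {z}`, evaluated at the rounded points. The two cases are joined with the coordinates
`|J|` and `∑ z ∈ J, z` of `I₁`. -/
noncomputable def gridKernel {n : ℕ} (ε : ℝ) (f₂ : Euc n → ℝ) (f₃ : Euc n → Euc n → ℝ)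
    (u : Fin n → UnitAddCircle) (p : Euc n × Euc n × IndepSet n (3 - 2)) : ℝ :=
  (1 - (p.2.2.1.card : ℝ)) * f₂ (gridRound ε u p.1 - gridRound ε u p.2.1) +
    (p.2.2.1.card : ℝ) * f₃ (gridRound ε u p.1 - gridRound ε u (∑ z ∈ p.2.2.1, z))
      (gridRound ε u p.2.1 - gridRound ε u (∑ z ∈ p.2.2.1, z))

theorem gridKernel_empty {n : ℕ} (ε : ℝ) (f₂ : Euc n → ℝ) (f₃ : Euc n → Euc n → ℝ)
    (u : Fin n → UnitAddCircle) (x y : Euc n) :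
    gridKernel ε f₂ f₃ u (x, y, IndepSet.empty n) = f₂ (gridRound ε u x - gridRound ε u y) := by
  simp [gridKernel, IndepSet.empty]

theorem gridKernel_single {n : ℕ} (ε : ℝ) (f₂ : Euc n → ℝ) (f₃ : Euc n → Euc n → ℝ)
    (u : Fin n → UnitAddCircle) (x y z : Euc n) :
    gridKernel ε f₂ f₃ u (x, y, IndepSet.single z) =
      f₃ (gridRound ε u x - gridRound ε u z) (gridRound ε u y - gridRound ε u z) := by
  simp [gridKernel, IndepSet.single]

theorem integrable_gridRound_sub {n : ℕ} {ε : ℝ} (hε : 0 < ε) (f : Euc n → ℝ) (x y : Euc n) :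
    Integrable (fun u => f (gridRound ε u x - gridRound ε u y)) (shiftMeasure n) := by
  simpa using integrable_gridRound hε (fun a b => f (a - b)) x y 0

theorem integrable_gridKernel {n : ℕ} {ε : ℝ} (hε : 0 < ε) (f₂ : Euc n → ℝ)
    (f₃ : Euc n → Euc n → ℝ) (p : Euc n × Euc n × IndepSet n (3 - 2)) :
    Integrable (fun u => gridKernel ε f₂ f₃ u p) (shiftMeasure n) :=
  ((integrable_gridRound_sub hε f₂ _ _).const_mul _).add
    ((integrable_gridRound hε f₃ _ _ _).const_mul _)

/-- The function `f₂` after rounding and averaging over the shift. -/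
noncomputable def gridAverage {n : ℕ} (ε : ℝ) (f : Euc n → ℝ) (x : Euc n) : ℝ :=
  ∫ u, f (gridRound ε u x - gridRound ε u 0) ∂shiftMeasure n

theorem continuous_gridAverage {n : ℕ} {ε : ℝ} (hε : 0 < ε) (f : Euc n → ℝ) :
    Continuous (gridAverage ε f) :=
  (continuous_integral_gridRound hε fun a _ => f a).comp
    (by fun_prop : Continuous fun x : Euc n => (x, x, (0 : Euc n)))

theorem gridAverage_const_mul {n : ℕ} (ε a : ℝ) (f : Euc n → ℝ) (x : Euc n) :
    gridAverage ε (fun x => a * f x) x = a * gridAverage ε f x :=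
  integral_const_mul _ _

theorem gridAverage_eq_zero {n : ℕ} {ε : ℝ} (hε : 0 ≤ ε) {f : Euc n → ℝ} {ρ : ℝ}
    (hf : ∀ x, ρ < ‖x‖ → f x = 0) {x : Euc n} (hx : ρ + 2 * ε * √n < ‖x‖) :
    gridAverage ε f x = 0 := by
  refine integral_eq_zero_of_ae (.of_forall fun u => hf _ ?_)
  have h1 := norm_gridRound_sub_gridRound_sub_le hε u x 0
  rw [sub_zero, norm_sub_rev] at h1
  have h2 := norm_le_norm_add_norm_sub' x (gridRound ε u x - gridRound ε u 0)
  linarith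

theorem hasCompactSupport_of_norm {n : ℕ} {f : Euc n → ℝ} {ρ : ℝ}
    (hf : ∀ x, ρ < ‖x‖ → f x = 0) : HasCompactSupport f :=
  HasCompactSupport.intro (isCompact_closedBall 0 ρ) fun x hx => hf x (by simpa using hx)

theorem abs_gridAverage_sub_le {n : ℕ} {ε : ℝ} (hε : 0 < ε) {f : Euc n → ℝ} {η : ℝ}
    (hf : ∀ a b : Euc n, dist a b ≤ 2 * ε * √n → dist (f a) (f b) ≤ η) (x : Euc n) :
    ‖gridAverage ε f x - f x‖ ≤ η := by
  have h : gridAverage ε f x - f x =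
      ∫ u, (f (gridRound ε u x - gridRound ε u 0) - f x) ∂shiftMeasure n := by
    rw [integral_sub (integrable_gridRound_sub hε f x 0) (integrable_const _)]
    simp [gridAverage]
  rw [h]
  refine (norm_integral_le_of_norm_le_const (C := η) (.of_forall fun u => ?_)).trans (by simp)
  have := norm_gridRound_sub_gridRound_sub_le hε.le u x 0
  rw [sub_zero, ← dist_eq_norm] at this
  simpa [dist_eq_norm] using hf _ _ this

theorem tendsto_integral_gridAverage {n : ℕ} {f : Euc n → ℝ} (hc : Continuous f) {ρ : ℝ}
    (hf : ∀ x, ρ < ‖x‖ → f x = 0) :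
    Tendsto (fun ε : ℝ => ∫ x, gridAverage ε f x) (𝓝[>] 0) (𝓝 (∫ x, f x)) := by
  set B := Metric.closedBall (0 : Euc n) (ρ + 2 * √n) with hB
  have hu := (hasCompactSupport_of_norm hf).uniformContinuous_of_continuous hc
  rw [Metric.tendsto_nhds]
  intro δ hδ
  -- Both functions are supported in `B` for `ε < 1`, so a uniform error `η` contributes `η vol B`.
  set η := δ / (2 * (volume.real B + 1)) with hη
  have hη0 : 0 < η := by positivity
  obtain ⟨θ, hθ, hθf⟩ := Metric.uniformContinuous_iff.1 hu η hη0
  have hsmall : ∀ᶠ ε : ℝ in 𝓝[>] 0, 2 * ε * √n < θ := by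
    refine (Tendsto.mono_left (Continuous.tendsto (by fun_prop) 0) nhdsWithin_le_nhds
      (f := fun ε : ℝ => 2 * ε * √n)).eventually_lt_const (by simpa using hθ)
  have hle1 : ∀ᶠ ε : ℝ in 𝓝[>] 0, ε < 1 := nhdsWithin_le_nhds (gt_mem_nhds one_pos)
  filter_upwards [hsmall, hle1, self_mem_nhdsWithin] with ε h1 h2 (h3 : 0 < ε)
  have hvan : ∀ x, ρ + 2 * ε * √n < ‖x‖ → gridAverage ε f x = 0 := fun x hx =>
    gridAverage_eq_zero h3.le hf hx
  have hi1 : Integrable (gridAverage ε f) :=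
    (continuous_gridAverage h3 f).integrable_of_hasCompactSupport (hasCompactSupport_of_norm hvan)
  have hi2 : Integrable f := hc.integrable_of_hasCompactSupport (hasCompactSupport_of_norm hf)
  rw [dist_eq_norm, ← integral_sub hi1 hi2, ← setIntegral_eq_integral_of_forall_compl_eq_zero
    (s := B)]
  · refine (norm_setIntegral_le_of_norm_le_const measure_closedBall_lt_top fun x _ =>
      abs_gridAverage_sub_le h3 (fun a b hab => (hθf (hab.trans_lt h1)).le) x).trans_lt ?_
    rw [hη, div_mul_eq_mul_div, div_lt_iff₀ (by positivity)]
    have : 0 ≤ volume.real B := measureReal_nonneg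
    nlinarith
  · intro x hx
    have hx' : ρ + 2 * √n < ‖x‖ := by simpa [hB] using hx
    have h4 : 0 ≤ √(n : ℝ) := Real.sqrt_nonneg _
    have h5 : ε * √n ≤ √n := mul_le_of_le_one_left h4 h2.le
    rw [hvan x (by linarith), hf x (by linarith), sub_zero]

theorem opB_integral {n : ℕ} {α : Type*} [MeasurableSpace α] {μ : Measure α}
    {T : α → Euc n × Euc n × IndepSet n (3 - 2) → ℝ} (hT : ∀ p, Integrable (fun u => T u p) μ)
    (S : Finset (Euc n)) (hS : (packingGraph n).IsIndepSet (S : Set (Euc n))) :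
    opB 3 (fun p => ∫ u, T u p ∂μ) S hS = ∫ u, opB 3 (T u) S hS ∂μ := by
  unfold opB
  rw [integral_finsetSum _ fun J _ => integrable_finsetSum _ fun p _ => hT _]
  refine Finset.sum_congr rfl fun J _ => ?_
  rw [integral_finsetSum _ fun p _ => hT _]

theorem opB_gridKernel_nonpos {n : ℕ} {r ε : ℝ} (hε : 0 < ε) (hr : 2 * ε * √n ≤ 2 - r)
    {f₂ : Euc n → ℝ} {f₃ : Euc n → Euc n → ℝ} (h : IsFeasiblePair n r f₂ f₃)
    (u : Fin n → UnitAddCircle) (S : Finset (Euc n))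
    (hS : (packingGraph n).IsIndepSet (S : Set (Euc n))) (h2 : 2 ≤ S.card) (h3 : S.card ≤ 3) :
    opB 3 (gridKernel ε f₂ f₃ u) S hS ≤ 0 := by
  classical
  have hdist : ∀ a ∈ S, ∀ b ∈ S, a ≠ b → r ≤ ‖gridRound ε u a - gridRound ε u b‖ := by
    intro a ha b hb hab
    have h4 : 2 ≤ ‖a - b‖ := isIndepSet_packingGraph_iff.1 hS a ha b hb hab
    have h5 := norm_gridRound_sub_gridRound_sub_le hε.le u a b
    rw [norm_sub_rev] at h5
    have h6 := norm_le_norm_add_norm_sub' (a - b) (gridRound ε u a - gridRound ε u b)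
    linarith
  obtain h4 | h4 : S.card = 2 ∨ S.card = 3 := by omega
  · obtain ⟨a, b, hab, rfl⟩ := Finset.card_eq_two.1 h4
    rw [opB_three_pair _ hab]
    simp only [gridKernel_empty, gridKernel_single, sub_self]
    have h5 := h.two_point _ (hdist a (by simp) b (by simp) hab)
    have h6 := h.two_point _ (hdist b (by simp) a (by simp) hab.symm)
    linarith
  · obtain ⟨a, b, c, hab, hac, hbc, rfl⟩ := Finset.card_eq_three.1 h4
    rw [opB_three_triple _ hab hac hbc]
    simp only [gridKernel_single]
    have h5 := h.three_point (gridRound ε u b - gridRound ε u a)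
      (gridRound ε u c - gridRound ε u a) (hdist b (by simp) a (by simp) hab.symm)
      (hdist c (by simp) a (by simp) hac.symm)
      (by rw [sub_sub_sub_cancel_right]; exact hdist b (by simp) c (by simp) hbc)
    rw [sub_sub_sub_cancel_right, sub_sub_sub_cancel_right, neg_sub, neg_sub] at h5
    have hs := h.posDef₃.1
    rw [hs (gridRound ε u c - gridRound ε u a), hs (gridRound ε u c - gridRound ε u b),
      hs (gridRound ε u b - gridRound ε u c)]
    linarith

theorem isKPointFeasible_gridKernel {n : ℕ} {r ε : ℝ} (hε : 0 < ε) (hr : 2 * ε * √n ≤ 2 - r)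
    {f₂ : Euc n → ℝ} {f₃ : Euc n → Euc n → ℝ} (h : IsFeasiblePair n r f₂ f₃) {ρ : ℝ}
    (hf : ∀ x, ρ < ‖x‖ → f₂ x = 0) (hI : ∫ x, gridAverage ε f₂ x = 1) :
    IsKPointFeasible n 3 fun p => ∫ u, gridKernel ε f₂ f₃ u p ∂shiftMeasure n where
  continuous := by
    have hcard : Continuous fun J : IndepSet n 1 => (J.1.card : ℝ) :=
      IndepSet.continuous_of_single (by simpa [IndepSet.single] using continuous_const)
    have hsum : Continuous fun J : IndepSet n 1 => ∑ z ∈ J.1, z :=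
      IndepSet.continuous_of_single (by simpa [IndepSet.single] using continuous_id')
    have hcard' : Continuous fun p : Euc n × Euc n × IndepSet n (3 - 2) => (p.2.2.1.card : ℝ) :=
      hcard.comp (continuous_snd.comp continuous_snd)
    have hsum' : Continuous fun p : Euc n × Euc n × IndepSet n (3 - 2) => ∑ z ∈ p.2.2.1, z :=
      hsum.comp (continuous_snd.comp continuous_snd)
    have h1 := (continuous_integral_gridRound hε fun a b => f₂ (a - b)).comp
      (continuous_fst.prodMk ((continuous_fst.comp continuous_snd).prodMk hsum'))
    have h2 := (continuous_integral_gridRound hε f₃).comp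
      (continuous_fst.prodMk ((continuous_fst.comp continuous_snd).prodMk hsum'))
    refine (((continuous_const (y := (1 : ℝ))).sub hcard').mul h1 |>.add
      (hcard'.mul h2)).congr fun p => ?_
    unfold gridKernel
    rw [integral_add ((integrable_gridRound_sub hε f₂ _ _).const_mul _)
      ((integrable_gridRound hε f₃ _ _ _).const_mul _), integral_const_mul, integral_const_mul]
    simp only [Function.comp_apply, Pi.add_apply, Pi.mul_apply, Pi.sub_apply,
      sub_sub_sub_cancel_right]
  translation_invariant x y z J := by
    rcases J.eq_empty_or_single with rfl | ⟨w, rfl⟩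
    · rw [IndepSet.translate_empty]
      simp only [gridKernel_empty, gridRound_add ε _ _ z, add_sub_add_right_eq_sub]
      exact (integral_add_right_eq_self (fun u => f₂ (gridRound ε u x - gridRound ε u y)) _).symm
    · rw [IndepSet.translate_single]
      simp only [gridKernel_single, gridRound_add ε _ _ z, add_sub_add_right_eq_sub]
      exact (integral_add_right_eq_self (fun u => f₃ (gridRound ε u x - gridRound ε u w)
        (gridRound ε u y - gridRound ε u w)) _).symm
  posDef J := by
    refine IsPosDefKernel.integral (fun u => ?_) fun x y => integrable_gridKernel hε f₂ f₃ _
    rcases J.eq_empty_or_single with rfl | ⟨w, rfl⟩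
    · simp only [gridKernel_empty]
      exact h.posDef₂.comp (gridRound ε u)
    · simp only [gridKernel_single]
      exact h.posDef₃.comp fun x => gridRound ε u x - gridRound ε u w
  opB_nonpos S hS h2 h3 := by
    rw [opB_integral (integrable_gridKernel hε f₂ f₃)]
    exact integral_nonpos fun u => opB_gridKernel_nonpos hε hr h u S hS h2 h3
  integrable := by
    refine ((continuous_gridAverage hε f₂).integrable_of_hasCompactSupport
      (hasCompactSupport_of_norm fun x hx => gridAverage_eq_zero hε.le hf hx)).congr
      (.of_forall fun x => ?_)
    exact integral_congr_ae (.of_forall fun u => (gridKernel_empty ε f₂ f₃ u x 0).symm)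
  integral_eq_one := by
    refine (integral_congr_ae (.of_forall fun x => ?_)).trans hI
    exact integral_congr_ae (.of_forall fun u => gridKernel_empty ε f₂ f₃ u x 0)

theorem IsFeasiblePair.kPointBound_le_gridAverage {n : ℕ} {r ε : ℝ} (hε : 0 < ε)
    (hr : 2 * ε * √n ≤ 2 - r) {f₂ : Euc n → ℝ} {f₃ : Euc n → Euc n → ℝ}
    (h : IsFeasiblePair n r f₂ f₃) {ρ : ℝ} (hf : ∀ x, ρ < ‖x‖ → f₂ x = 0)
    (hI : 0 < ∫ x, gridAverage ε f₂ x) :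
    kPointBound 3 n ≤ ((volume.real (Metric.closedBall (0 : Euc n) 1) *
      ((f₂ 0 + f₃ 0 0) / ∫ x, gridAverage ε f₂ x) : ℝ) : EReal) := by
  set c := (∫ x, gridAverage ε f₂ x)⁻¹ with hc
  have hk := isKPointFeasible_gridKernel hε hr (h.const_mul (inv_nonneg.2 hI.le)) (ρ := ρ)
    (fun x hx => by rw [hf x hx, mul_zero])
    (by simp_rw [gridAverage_const_mul, integral_const_mul, inv_mul_cancel₀ hI.ne'])
  refine sInf_le ⟨_, hk, ?_⟩
  rw [opB_three_singleton]
  simp only [gridKernel_empty, gridKernel_single, sub_self, integral_const, probReal_univ,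
    one_smul, div_eq_inv_mul, mul_add]

theorem IsFeasiblePair.kPointBound_le_of_support {n : ℕ} {r : ℝ} (hr : r < 2) {f₂ : Euc n → ℝ}
    {f₃ : Euc n → Euc n → ℝ} (h : IsFeasiblePair n r f₂ f₃) {ρ : ℝ}
    (hf : ∀ x, ρ < ‖x‖ → f₂ x = 0) (hI : 0 < ∫ x, f₂ x) :
    kPointBound 3 n ≤ ((volume.real (Metric.closedBall (0 : Euc n) 1) *
      ((f₂ 0 + f₃ 0 0) / ∫ x, f₂ x) : ℝ) : EReal) := by
  have ht := tendsto_integral_gridAverage h.continuous hf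
  refine EReal.le_coe_of_tendsto (l := 𝓝[>] (0 : ℝ))
    ((tendsto_const_nhds.div ht hI.ne').const_mul _) ?_
  have hsmall : ∀ᶠ ε : ℝ in 𝓝[>] 0, 2 * ε * √n < 2 - r := by
    refine (Tendsto.mono_left (Continuous.tendsto (by fun_prop) 0) nhdsWithin_le_nhds
      (f := fun ε : ℝ => 2 * ε * √n)).eventually_lt_const (by simpa using hr)
  filter_upwards [hsmall, ht.eventually_const_lt hI, self_mem_nhdsWithin] with ε h1 h2 h3
  exact h.kPointBound_le_gridAverage h3 h1.le hf h2

theorem IsFeasiblePair.kPointBound_le_of_lt {n : ℕ} {r : ℝ} (hr : r < 2) {f₂ : Euc n → ℝ}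
    {f₃ : Euc n → Euc n → ℝ} (h : IsFeasiblePair n r f₂ f₃) (hI : 0 < ∫ x, f₂ x) :
    kPointBound 3 n ≤ ((volume.real (Metric.closedBall (0 : Euc n) 1) *
      ((f₂ 0 + f₃ 0 0) / ∫ x, f₂ x) : ℝ) : EReal) := by
  refine EReal.le_coe_of_tendsto (tendsto_div_integral_truncate h.integrable hI _ _) ?_
  filter_upwards [eventually_gt_atTop 0,
    (tendsto_integral_mul_ballOverlap h.integrable).eventually_const_lt hI] with ρ hρ hpos
  have := (h.truncate ρ⁻¹).kPointBound_le_of_support hr (ρ := 2 * ρ)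
    (fun x hx => by rw [ballOverlap_inv_smul_eq_zero hρ hx, mul_zero]) hpos
  simpa [ballOverlap_zero] using this

/-- The limit of the values of the pair dilated to distances `r / c < 2`, as `c` decreases to
`r / 2`. -/
theorem IsFeasiblePair.kPointBound_le {n : ℕ} {r : ℝ} (hr : 0 < r) {f₂ : Euc n → ℝ}
    {f₃ : Euc n → Euc n → ℝ} (h : IsFeasiblePair n r f₂ f₃) (hI : ∫ x, f₂ x = 1) :
    kPointBound 3 n ≤ ((volume.real (Metric.closedBall (0 : Euc n) (r / 2)) *
      (f₂ 0 + f₃ 0 0) : ℝ) : EReal) := by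
  have ht : Tendsto (fun c : ℝ => volume.real (Metric.closedBall (0 : Euc n) 1) *
      (c ^ n * (f₂ 0 + f₃ 0 0))) (𝓝[>] (r / 2))
      (𝓝 (volume.real (Metric.closedBall (0 : Euc n) (r / 2)) * (f₂ 0 + f₃ 0 0))) := by
    rw [volume_real_closedBall_euc (by positivity : 0 ≤ r / 2), mul_comm ((r / 2) ^ n), mul_assoc]
    exact (Continuous.tendsto (by fun_prop) (r / 2)).mono_left nhdsWithin_le_nhds
  refine EReal.le_coe_of_tendsto ht ?_
  filter_upwards [self_mem_nhdsWithin] with c (hc : r / 2 < c)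
  have hc0 : 0 < c := lt_trans (by positivity) hc
  have hint := integral_comp_smul_euc f₂ hc0
  have := (h.comp_smul hc0).kPointBound_le_of_lt (by rw [div_lt_iff₀ hc0]; linarith)
    (by rw [hint, hI]; positivity)
  rwa [hint, hI, smul_zero, div_div_eq_mul_div, div_one, mul_comm (_ + _)] at this

theorem kPointBound_le_strengthenedBound {n : ℕ} {r : ℝ} (hr : 0 < r) :
    kPointBound 3 n ≤ strengthenedBound n r ⊤ := by
  refine le_sInf ?_
  rintro _ ⟨f₂, f₃, h, rfl⟩
  exact h.isFeasiblePair.kPointBound_le hr h.integral_eq_one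

theorem theorem2p4 (n : ℕ) :
    (∀ r : ℝ, 0 < r → strengthenedBound n r ⊤ = kPointBound 3 n) ∧
    (⨅ (r : ℝ) (R : ℝ) (_ : 0 < r) (_ : r < R), strengthenedBound n r (R : EReal)) =
      kPointBound 3 n := by
  refine ⟨fun r hr => le_antisymm (strengthenedBound_top_le_kPointBound hr)
    (kPointBound_le_strengthenedBound hr), le_antisymm iInf_strengthenedBound_le_kPointBound ?_⟩
  exact le_iInf₂ fun r R => le_iInf₂ fun hr _ =>
    (kPointBound_le_strengthenedBound hr).trans (strengthenedBound_top_le _)
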